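/- **Definitions.** A *temporal-sampling* of a metric space $M=(X,d)$ is a sequence $P=(P_1,\dots,P_t)$, $t\ge 1$, of finite non-empty subsets of $X$ (its *levels*); its *size* is $n=\sum_{i=1}^t|P_i|$. A *pseudo-ultrametric* on a set is a pseudometric $\mu$ with $\mu(x,z)\le\max\{\mu(x,y),\mu(y,z)\}$ for all $x,y,z$; it is an *ultrametric* if moreover $\mu(x,y)=0$ implies $x=y$. For functions $\mu,\nu:Q\times Q\to\mathbb{R}$ on a finite non-empty set $Q$ let $L^\infty(\mu,\nu)=\max_{x,y\in Q}|\mu(x,y)-\nu(x,y)|$. A *correspondence* between $U$ and $V$ is a relation $\mathcal{C}\subseteq U\times V$ whose projections to $U$ and to $V$ are onto. For real $\chi,\delta\ge 0$, a *local $(\chi,\delta)$-clustering* of $P$ consists of pseudo-ultrametrics $\mu_i$ on $P_i$ with $L^\infty(d|_{P_i},\mu_i)\le\chi$ for $1\le i\le t$, and of correspondences $\mathcal{C}_i$ between $P_i$ and $P_{i+1}$ with $d(u,v)\le\delta$ for all $(u,v)\in\mathcal{C}_i$, for $1\le i<t$. Let $d_H$ denote the Hausdorff distance in $M$. Algorithms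 are programs for a real RAM. It has registers and arrays of natural numbers and of real numbers (arrays are addressed by natural-number registers); assigning a constant (a natural or a rational number), copying, addition and truncated subtraction of natural numbers, the four operations on real numbers, reading or writing an array cell, and comparing two registers take one step each. The input consists of $t$, of $|P_1|,\dots,|P_t|$, and of the $n\times n$ matrix of the distances between the points of the levels, listed level by level and in an arbitrary order within each level. The numbers $\chi$ and $\delta$ are not part of the input. **Theorem.** There are a program and a constant $c$ such that, for every metric space $M=(X,d)$ and every temporal-sampling $P$ of $M$ of size $n$, the program halts on input $P$ after at most $c\,n^2$ steps and returns functions $\mu_i:P_i\times P_i\to\mathbb{R}$ $(1\le i\le t)$ and relations $\mathcal{C}_i\subseteq P_i\times P_{i+1}$ $(1\le i<t)$ such that 1. for all $\chi,\delta\ge 0$ for which $P$ admits a local $(\chi,\delta)$-clustering, $\big((\mu_i)_{i},(\mathcal{C}_i)_{i}\big)$ is a local $(\chi,\delta)$-clustering of $P$; 2. each $\mu_i$ is an ultrametric on $P_i$ that is $\ell^\infty$-nearest to $d|_{P_i}$, that is, $L^\infty(d|_{P_i},\mu_i)\le L^\infty(d|_{P_i},\nu)$ for every pseudo-ultrametric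 (in particular for every ultrametric) $\nu$ on $P_i$; 3. $\mathcal{C}_i=\{(u,v)\in P_i\times P_{i+1}: d(u,v)\le d_H(P_i,P_{i+1})\}$ for $1\le i<t$. Moreover $\delta'=\max_{1\le i<t}d_H(P_i,P_{i+1})$ (read as $0$ if $t=1$) is the least $\delta\ge 0$ such that $P$ admits a local $(\chi,\delta)$-clustering for some $\chi\ge 0$. -/

import Mathlib

namespace TemporalClustering

/-! ### A unit-cost real RAM

The machine has two sorts of values, natural numbers (used for counting and addressing) and real
numbers.  For each sort there are registers, named directly in the program, and arrays.  Arrays are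
named in the program and are addressed by the content of a natural-number register.  There is no
conversion from real numbers to natural numbers (in particular no rounding) and no multiplication
of natural numbers. -/

/-- A machine configuration: registers and arrays of both sorts. -/
structure State where
  nreg : ℕ → ℕ
  rreg : ℕ → ℝ
  narr : ℕ → ℕ → ℕ
  rarr : ℕ → ℕ → ℝ

/-- Elementary instructions.  The first argument of each register instruction is its destination. -/
inductive Instr where
  | nconst (d c : ℕ)
  | nmove (d a : ℕ)
  | nadd (d a b : ℕ)
  | nsub (d a b : ℕ)
  | nload (d k a : ℕ)
  | nstore (k a v : ℕ)
  | rconst (d : ℕ) (q : ℚ)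
  | rmove (d a : ℕ)
  | radd (d a b : ℕ)
  | rsub (d a b : ℕ)
  | rmul (d a b : ℕ)
  | rdiv (d a b : ℕ)
  | rload (d k a : ℕ)
  | rstore (k a v : ℕ)

/-- Comparisons of two registers of the same sort. -/
inductive Test where
  | nle (a b : ℕ)
  | nlt (a b : ℕ)
  | rle (a b : ℕ)
  | rlt (a b : ℕ)

/-- Programs: finite texts built from elementary instructions, branching and loops. -/
inductive Program where
  | skip
  | instr (i : Instr)
  | seq (p q : Program)
  | ite (b : Test) (p q : Program)
  | loop (b : Test) (p : Program)

namespace State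

def setN (s : State) (d v : ℕ) : State := { s with nreg := Function.update s.nreg d v }

noncomputable def setR (s : State) (d : ℕ) (v : ℝ) : State :=
  { s with rreg := Function.update s.rreg d v }

/-- Write `v` at address `a` of the natural-number array `k`. -/
def writeN (s : State) (k a v : ℕ) : State :=
  { s with narr := Function.update s.narr k (Function.update (s.narr k) a v) }

/-- Write `v` at address `a` of the real array `k`. -/
noncomputable def writeR (s : State) (k a : ℕ) (v : ℝ) : State :=
  { s with rarr := Function.update s.rarr k (Function.update (s.rarr k) a v) }

end State

/-- The effect of one elementary instruction. -/
noncomputable def Instr.apply : Instr → State → State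
  | .nconst d c, s => s.setN d c
  | .nmove d a, s => s.setN d (s.nreg a)
  | .nadd d a b, s => s.setN d (s.nreg a + s.nreg b)
  | .nsub d a b, s => s.setN d (s.nreg a - s.nreg b)
  | .nload d k a, s => s.setN d (s.narr k (s.nreg a))
  | .nstore k a v, s => s.writeN k (s.nreg a) (s.nreg v)
  | .rconst d q, s => s.setR d (q : ℝ)
  | .rmove d a, s => s.setR d (s.rreg a)
  | .radd d a b, s => s.setR d (s.rreg a + s.rreg b)
  | .rsub d a b, s => s.setR d (s.rreg a - s.rreg b)
  | .rmul d a b, s => s.setR d (s.rreg a * s.rreg b)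
  | .rdiv d a b, s => s.setR d (s.rreg a / s.rreg b)
  | .rload d k a, s => s.setR d (s.rarr k (s.nreg a))
  | .rstore k a v, s => s.writeR k (s.nreg a) (s.rreg v)

/-- Whether a comparison succeeds in a given configuration. -/
def Test.Holds : Test → State → Prop
  | .nle a b, s => s.nreg a ≤ s.nreg b
  | .nlt a b, s => s.nreg a < s.nreg b
  | .rle a b, s => s.rreg a ≤ s.rreg b
  | .rlt a b, s => s.rreg a < s.rreg b

/-- `Exec p s s' T`: started in `s`, the program `p` halts in `s'` after exactly `T` steps, where
every executed elementary instruction and every evaluated comparison is one step. -/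
inductive Exec : Program → State → State → ℕ → Prop where
  | skip (s : State) : Exec .skip s s 0
  | instr (i : Instr) (s : State) : Exec (.instr i) s (i.apply s) 1
  | seq {p q : Program} {s s' s'' : State} {m n : ℕ} :
      Exec p s s' m → Exec q s' s'' n → Exec (.seq p q) s s'' (m + n)
  | ite_true {b : Test} {p q : Program} {s s' : State} {m : ℕ} :
      b.Holds s → Exec p s s' m → Exec (.ite b p q) s s' (m + 1)
  | ite_false {b : Test} {p q : Program} {s s' : State} {m : ℕ} :
      ¬ b.Holds s → Exec q s s' m → Exec (.ite b p q) s s' (m + 1)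
  | loop_true {b : Test} {p : Program} {s s' s'' : State} {m n : ℕ} :
      b.Holds s → Exec p s s' m → Exec (.loop b p) s' s'' n →
        Exec (.loop b p) s s'' (m + n + 1)
  | loop_false {b : Test} {p : Program} {s : State} :
      ¬ b.Holds s → Exec (.loop b p) s s 1

/-! ### Pseudo-ultrametrics and correspondences -/

/-- `μ` is the distance function of a pseudo-ultrametric space on `α`. -/
structure IsPseudoUltrametric {α : Type*} (μ : α → α → ℝ) : Prop where
  nonneg : ∀ x y, 0 ≤ μ x y
  self : ∀ x, μ x x = 0
  symm : ∀ x y, μ x y = μ y x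
  ultra : ∀ x y z, μ x z ≤ max (μ x y) (μ y z)

/-- `μ` is the distance function of an ultrametric space on `α`. -/
structure IsUltrametric {α : Type*} (μ : α → α → ℝ) : Prop extends IsPseudoUltrametric μ where
  eq_of_zero : ∀ x y, μ x y = 0 → x = y

/-- The `ℓ^∞` distance of two distance functions (a maximum, when `α` is finite and non-empty). -/
noncomputable def LInf {α : Type*} (μ ν : α → α → ℝ) : ℝ :=
  ⨆ q : α × α, |μ q.1 q.2 - ν q.1 q.2|

/-- A correspondence between `α` and `β`: both projections are onto. -/
def IsCorrespondence {α β : Type*} (C : Set (α × β)) : Prop :=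
  Prod.fst '' C = Set.univ ∧ Prod.snd '' C = Set.univ

/-! ### Temporal samplings and local clusterings -/

/-- A temporal-sampling of length `t + 1`: a sequence of `t + 1` finite non-empty subsets of `X`. -/
structure TemporalSampling (X : Type*) (t : ℕ) where
  level : Fin (t + 1) → Finset X
  nonempty : ∀ i, (level i).Nonempty

namespace TemporalSampling

variable {X : Type*} {t : ℕ}

/-- The size: the sum of the numbers of points of the levels. -/
def size (P : TemporalSampling X t) : ℕ := ∑ i, (P.level i).card

/-- A distance function on every level. -/
abbrev LevelDist (P : TemporalSampling X t) : Type _ :=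
  ∀ i : Fin (t + 1), P.level i → P.level i → ℝ

/-- A relation between any two successive levels. -/
abbrev LevelRel (P : TemporalSampling X t) : Type _ :=
  ∀ i : Fin t, Set (P.level i.castSucc × P.level i.succ)

/-- The restriction of the ambient metric to the levels. -/
def ambient [MetricSpace X] (P : TemporalSampling X t) : P.LevelDist :=
  fun _ x y => dist (x : X) (y : X)

/-- The Hausdorff distance of the `i`-th level and its successor in the ambient space. -/
noncomputable def hausdorff [MetricSpace X] (P : TemporalSampling X t) (i : Fin t) : ℝ :=
  Metric.hausdorffDist (P.level i.castSucc : Set X) (P.level i.succ : Set X)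

/-- `(μ, C)` is a local `(χ, δ)`-clustering of `P`. -/
structure IsLocalClustering [MetricSpace X] (P : TemporalSampling X t) (χ δ : ℝ)
    (μ : P.LevelDist) (C : P.LevelRel) : Prop where
  chi_nonneg : 0 ≤ χ
  delta_nonneg : 0 ≤ δ
  ultra : ∀ i, IsPseudoUltrametric (μ i)
  fit : ∀ i, LInf (P.ambient i) (μ i) ≤ χ
  corr : ∀ i, IsCorrespondence (C i)
  loc : ∀ i, ∀ q ∈ C i, dist (q.1 : X) (q.2 : X) ≤ δ

/-- `P` admits a local `(χ, δ)`-clustering. -/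
def Admits [MetricSpace X] (P : TemporalSampling X t) (χ δ : ℝ) : Prop :=
  ∃ (μ : P.LevelDist) (C : P.LevelRel), P.IsLocalClustering χ δ μ C

/-! ### Input and output of programs

The points of the input are numbered `0, …, n - 1`, level after level and within each level in an
arbitrary order. -/

/-- An order in which the points of each level are listed in the input. -/
abbrev Enumeration (P : TemporalSampling X t) : Type _ :=
  ∀ i, Fin (P.level i).card ≃ P.level i

/-- The number of a point of the `i`-th level. -/
def index (P : TemporalSampling X t) (e : P.Enumeration) (i : Fin (t + 1)) (x : P.level i) :
    Fin P.size :=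
  finSigmaFinEquiv ⟨i, (e i).symm x⟩

/-- The point with a given number. -/
def point (P : TemporalSampling X t) (e : P.Enumeration) (a : Fin P.size) : X :=
  let s : (i : Fin (t + 1)) × Fin (P.level i).card := finSigmaFinEquiv.symm a
  (e s.1 s.2 : X)

/-- The initial configuration.  Natural-number array `0` holds the number of levels, followed by
their cardinalities; real array `0` holds the `n × n` matrix of the distances of the points, row by
row; everything else is `0`. -/
noncomputable def input [MetricSpace X] (P : TemporalSampling X t) (e : P.Enumeration) : State where
  nreg := fun _ => 0
  rreg := fun _ => 0
  narr := fun k a =>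
    if k = 0 then
      if a = 0 then t + 1
      else if h : a - 1 < t + 1 then (P.level ⟨a - 1, h⟩).card else 0
    else 0
  rarr := fun k a =>
    if k = 0 then
      if h : a < P.size * P.size then
        dist (P.point e (Fin.divNat ⟨a, h⟩)) (P.point e (Fin.modNat ⟨a, h⟩))
      else 0
    else 0

/-- The distance functions returned by a program: real array `1`, read as an `n × n` matrix. -/
def outputDist (P : TemporalSampling X t) (e : P.Enumeration) (s : State) : P.LevelDist :=
  fun i x y => s.rarr 1 ((P.index e i x : ℕ) * P.size + (P.index e i y : ℕ))

/-- The relations returned by a program: natural-number array `1`, read as an `n × n` matrix in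
which the entry `1` marks the related pairs. -/
def outputRel (P : TemporalSampling X t) (e : P.Enumeration) (s : State) : P.LevelRel :=
  fun i => {q | s.narr 1 ((P.index e i.castSucc q.1 : ℕ) * P.size +
    (P.index e i.succ q.2 : ℕ)) = 1}

end TemporalSampling

end TemporalClustering

open TemporalClustering

/-!
The program treats every level separately by single linkage, and every pair of successive levels
by its Hausdorff distance; all of this is done on the matrix of distances in quadratic time.

*Nearest ultrametrics.*  Let `u` be the largest ultrametric below `d` on a level and let `E` be the
largest value of `d - u`.  If `ν` is a pseudo-ultrametric with `|d - ν| ≤ χ`, then `ν ≤ d + χ`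
implies `ν ≤ u + χ`, hence `d - u ≤ 2 χ` and `E / 2 ≤ χ`.  On the other hand `u + E / 2` (off the
diagonal) is an ultrametric at distance at most `E / 2` from `d`.  See `isUltrametric_shift` and
`LInf_shift_le`.

*Single linkage.*  Prim's algorithm reaches the points one by one, always at the smallest distance
`w` from the set `S` of the points reached so far.  If `v` was reached last and `v'` is reached
next, then `u v' x = max (u v x) w` for all `x ∈ S`.  Only the previous point `v` matters, no matter
which point of `S` is closest to `v'`, because `u v x` is at most the distance of `x` from every
point that has not been reached (`PrimInvariant`, `PrimInvariant.insert`).  One run serves all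
levels: points of different levels are given a common dissimilarity `B` that bounds all distances.
Chains through other levels are then useless, and the restriction of the result to a level is the
largest ultrametric of this level.

*Relations.*  The Hausdorff distance of two finite sets is the least `r` for which each point of
either set is within distance `r` of the other set, which both makes the relation of all pairs
within that distance a correspondence and bounds the locality of any correspondence from below
(`hausdorff_le_iff`, `isCorrespondence_hausdorff`, `IsLocalClustering.hausdorff_le`).

*Running time.*  `Terminates p s T Q` combines correctness with a bound on the number of
steps.  Loops are treated by `Terminates.forLoop`; what a program leaves unchanged is read off from
its text by `Exec.frame`, and programs without loops are evaluated (`Terminates.of_eval`).  All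
loops run over the points, over the pairs of points, or over the levels, of which there are at most
`n`.
-/

namespace TemporalClustering

/-! ### Reasoning about programs -/

/-- Whether an instruction may change the natural-number register `r`. -/
def Instr.wN : Instr → ℕ → Bool
  | .nconst d _, r | .nmove d _, r | .nadd d _ _, r | .nsub d _ _, r | .nload d _ _, r => d == r
  | _, _ => false

/-- Whether an instruction may change the real register `r`. -/
def Instr.wR : Instr → ℕ → Bool
  | .rconst d _, r | .rmove d _, r | .radd d _ _, r | .rsub d _ _, r | .rmul d _ _, r
  | .rdiv d _ _, r | .rload d _ _, r => d == r
  | _, _ => false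

/-- Whether an instruction may change the natural-number array `k`. -/
def Instr.wNA : Instr → ℕ → Bool
  | .nstore k' _ _, k => k' == k
  | _, _ => false

/-- Whether an instruction may change the real array `k`. -/
def Instr.wRA : Instr → ℕ → Bool
  | .rstore k' _ _, k => k' == k
  | _, _ => false

/-- Whether some instruction of a program satisfies a Boolean predicate. -/
def Program.any (f : Instr → Bool) : Program → Bool
  | .skip => false
  | .instr i => f i
  | .seq p q => p.any f || q.any f
  | .ite _ p q => p.any f || q.any f
  | .loop _ p => p.any f

/-- `s'` agrees with `s` in every register and every array which does not occur as a destination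
in the program `p`. -/
structure Frame (p : Program) (s s' : State) : Prop where
  nreg : ∀ r, p.any (·.wN r) = false → s'.nreg r = s.nreg r
  rreg : ∀ r, p.any (·.wR r) = false → s'.rreg r = s.rreg r
  narr : ∀ k, p.any (·.wNA k) = false → s'.narr k = s.narr k
  rarr : ∀ k, p.any (·.wRA k) = false → s'.rarr k = s.rarr k

theorem Frame.refl (p : Program) (s : State) : Frame p s s :=
  ⟨fun _ _ => rfl, fun _ _ => rfl, fun _ _ => rfl, fun _ _ => rfl⟩

theorem Frame.trans {p : Program} {s s' s'' : State} (h : Frame p s s') (h' : Frame p s' s'') :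
    Frame p s s'' :=
  ⟨fun r hr => (h'.nreg r hr).trans (h.nreg r hr), fun r hr => (h'.rreg r hr).trans (h.rreg r hr),
    fun r hr => (h'.narr r hr).trans (h.narr r hr), fun r hr => (h'.rarr r hr).trans (h.rarr r hr)⟩

/-- A frame for a program is a frame for every program with at least the same destinations. -/
theorem Frame.mono {p q : Program} {s s' : State} (h : Frame p s s')
    (hpq : ∀ f, q.any f = false → p.any f = false) : Frame q s s' :=
  ⟨fun r hr => h.nreg r (hpq _ hr), fun r hr => h.rreg r (hpq _ hr),
    fun r hr => h.narr r (hpq _ hr), fun r hr => h.rarr r (hpq _ hr)⟩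

theorem Frame.instr (i : Instr) (s : State) : Frame (.instr i) s (i.apply s) := by
  constructor <;> intro r hr <;> cases i <;>
    simp [Program.any, Instr.wN, Instr.wR, Instr.wNA, Instr.wRA, Instr.apply, State.setN,
      State.setR, State.writeN, State.writeR, Function.update_apply] at hr ⊢ <;>
    exact fun h => absurd h.symm hr

theorem Exec.frame {p : Program} {s s' : State} {m : ℕ} (h : Exec p s s' m) : Frame p s s' := by
  induction h with
  | skip s => exact Frame.refl _ _
  | instr i s => exact Frame.instr i s
  | seq _ _ ih₁ ih₂ =>
    exact (ih₁.mono fun f hf => by simp_all [Program.any]).trans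
      (ih₂.mono fun f hf => by simp_all [Program.any])
  | ite_true _ _ ih => exact ih.mono fun f hf => by simp_all [Program.any]
  | ite_false _ _ ih => exact ih.mono fun f hf => by simp_all [Program.any]
  | loop_true _ _ _ ih₁ ih₂ => exact (ih₁.mono fun f hf => by simpa [Program.any] using hf).trans ih₂
  | loop_false _ => exact Frame.refl _ _

/-- Started in `s`, the program `p` halts after at most `T` steps in a configuration that
satisfies `Q`. -/
def Terminates (p : Program) (s : State) (T : ℕ) (Q : State → Prop) : Prop :=
  ∃ s' m, Exec p s s' m ∧ m ≤ T ∧ Q s'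

theorem Terminates.mono {p : Program} {s : State} {T T' : ℕ} {Q Q' : State → Prop}
    (h : Terminates p s T Q) (hT : T ≤ T') (hQ : ∀ s', Frame p s s' → Q s' → Q' s') :
    Terminates p s T' Q' := by
  obtain ⟨s', m, he, hm, hq⟩ := h
  exact ⟨s', m, he, hm.trans hT, hQ s' he.frame hq⟩

theorem Terminates.seq {p q : Program} {s : State} {T T' : ℕ} {R Q : State → Prop}
    (hp : Terminates p s T R) (hq : ∀ s', Frame p s s' → R s' → Terminates q s' T' Q) :
    Terminates (.seq p q) s (T + T') Q := by
  obtain ⟨s', m, he, hm, hr⟩ := hp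
  obtain ⟨s'', m', he', hm', hq⟩ := hq s' he.frame hr
  exact ⟨s'', m + m', he.seq he', by omega, hq⟩

/-- The effect of a program without loops. -/
noncomputable def Program.eval : Program → State → State
  | .skip, s => s
  | .instr i, s => i.apply s
  | .seq p q, s => q.eval (p.eval s)
  | .ite b p q, s => open Classical in if b.Holds s then p.eval s else q.eval s
  | .loop _ _, s => s

/-- A bound for the running time of a program without loops, and `none` if there are loops. -/
def Program.cost : Program → Option ℕ
  | .skip => some 0
  | .instr _ => some 1
  | .seq p q => p.cost.bind fun m => q.cost.map fun n => m + n
  | .ite _ p q => p.cost.bind fun m => q.cost.map fun n => max m n + 1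
  | .loop _ _ => none

theorem Terminates.of_eval {p : Program} {s : State} {T : ℕ} {Q : State → Prop}
    (hT : p.cost = some T) (hQ : Q (p.eval s)) : Terminates p s T Q := by
  suffices h : ∃ m, Exec p s (p.eval s) m ∧ m ≤ T by
    obtain ⟨m, h, hm⟩ := h
    exact ⟨_, m, h, hm, hQ⟩
  clear hQ
  induction p generalizing s T with
  | skip => exact ⟨0, .skip s, Nat.zero_le _⟩
  | instr i =>
    simp only [Program.cost, Option.some.injEq] at hT
    exact ⟨1, .instr i s, hT.le⟩
  | seq p q ihp ihq =>
    simp only [Program.cost, Option.bind_eq_some_iff, Option.map_eq_some_iff] at hT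
    obtain ⟨a, ha, b, hb, rfl⟩ := hT
    obtain ⟨m, h, hm⟩ := ihp (s := s) ha
    obtain ⟨m', h', hm'⟩ := ihq (s := p.eval s) hb
    exact ⟨m + m', h.seq h', by omega⟩
  | ite b p q ihp ihq =>
    simp only [Program.cost, Option.bind_eq_some_iff, Option.map_eq_some_iff] at hT
    obtain ⟨x, hx, y, hy, rfl⟩ := hT
    by_cases hb : b.Holds s
    · obtain ⟨m, h, hm⟩ := ihp (s := s) hx
      exact ⟨m + 1, by simpa [Program.eval, hb] using Exec.ite_true hb h, by omega⟩
    · obtain ⟨m, h, hm⟩ := ihq (s := s) hy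
      exact ⟨m + 1, by simpa [Program.eval, hb] using Exec.ite_false hb h, by omega⟩
  | loop b p ih => simp [Program.cost] at hT

/-- The instructions of a list, one after the other. -/
def block : List Instr → Program
  | [] => .skip
  | i :: l => .seq (.instr i) (block l)

/-- Branching on the equality of two natural-number registers. -/
def ifEq (a b : ℕ) (p q : Program) : Program := .ite (.nle a b) (.ite (.nle b a) p q) q

theorem eval_ifEq (a b : ℕ) (p q : Program) (s : State) :
    (ifEq a b p q).eval s = if s.nreg a = s.nreg b then p.eval s else q.eval s := by
  rcases lt_trichotomy (s.nreg a) (s.nreg b) with h | h | h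
  · simp [ifEq, Program.eval, Test.Holds, h.le, h.not_ge, h.ne]
  · simp [ifEq, Program.eval, Test.Holds, h]
  · simp [ifEq, Program.eval, Test.Holds, h.not_ge, h.ne']

/-- Execute `p` with the register `i` running from `0` to the content of the register `r`
(exclusive).  Register `1` has to contain the number `1`. -/
def forLoop (i r : ℕ) (p : Program) : Program :=
  .seq (.instr (.nconst i 0)) (.loop (.nlt i r) (.seq p (.instr (.nadd i i 1))))

/-- The invariant rule for counting loops.  The invariant need only describe what the loop
changes: the remaining content of the configuration is supplied by the frame condition. -/
theorem Terminates.forLoop {i r : ℕ} {p : Program} {s : State} {N c : ℕ} (I : ℕ → State → Prop)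
    (hN : s.nreg r = N) (h1 : s.nreg 1 = 1)
    (hi : p.any (·.wN i) = false) (hr : p.any (·.wN r) = false) (ho : p.any (·.wN 1) = false)
    (hir : i ≠ r) (hio : i ≠ 1)
    (h0 : I 0 (s.setN i 0))
    (step : ∀ k s', k < N → s'.nreg i = k → Frame (forLoop i r p) s s' → I k s' →
      Terminates p s' c fun s'' => I (k + 1) (s''.setN i (k + 1))) :
    Terminates (forLoop i r p) s (N * (c + 2) + 2) (I N) := by
  suffices h : ∀ j k s', k + j = N → s'.nreg i = k → s'.nreg r = N → s'.nreg 1 = 1 →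
      Frame (TemporalClustering.forLoop i r p) s s' → I k s' →
      Terminates (.loop (.nlt i r) (.seq p (.instr (.nadd i i 1)))) s' (j * (c + 2) + 1) (I N) by
    have h' := h N 0 (s.setN i 0) (by omega) (by simp [State.setN])
      (by simp [State.setN, hN, hir.symm]) (by simp [State.setN, h1, hio.symm])
      ((Frame.instr (.nconst i 0) s).mono fun f hf => by
        simp_all [TemporalClustering.forLoop, Program.any]) h0
    obtain ⟨s', m, he, hm, hq⟩ := h'
    exact ⟨s', 1 + m, (Exec.instr (.nconst i 0) s).seq he, by omega, hq⟩
  intro j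
  induction j with
  | zero =>
    intro k s' hk hki hkr hk1 hF hI
    obtain rfl : k = N := by omega
    exact ⟨s', 1, .loop_false (by simp [Test.Holds, hki, hkr]), by omega, hI⟩
  | succ j ih =>
    intro k s' hk hki hkr hk1 hF hI
    obtain ⟨s₁, m, he, hm, hQ⟩ := step k s' (by omega) hki hF hI
    have hs : (Instr.nadd i i 1).apply s₁ = s₁.setN i (k + 1) := by
      simp [Instr.apply, he.frame.nreg i hi, he.frame.nreg 1 ho, hki, hk1]
    have he' : Exec (.seq p (.instr (.nadd i i 1))) s' (s₁.setN i (k + 1)) (m + 1) := by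
      rw [← hs]
      exact he.seq (.instr _ _)
    obtain ⟨s₂, m', he₂, hm', hQ'⟩ := ih (k + 1) (s₁.setN i (k + 1)) (by omega)
      (by simp [State.setN])
      (by simp [State.setN, hir.symm, he.frame.nreg r hr, hkr])
      (by simp [State.setN, hio.symm, he.frame.nreg 1 ho, hk1])
      (hF.trans (he'.frame.mono fun f hf => by
        simp_all [TemporalClustering.forLoop, Program.any])) hQ
    refine ⟨s₂, m + 1 + m' + 1, .loop_true ?_ he' he₂, ?_, hQ'⟩
    · simp only [Test.Holds, hki, hkr]
      omega
    · have := Nat.add_one_mul j (c + 2)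
      omega

/-! ### Growing the largest ultrametric below a dissimilarity -/

/-- The invariant of Prim's algorithm for a dissimilarity `d` on `{0, …, n - 1}`: `S` is the set
of the points that have been reached, `v` the point reached last, and `u` restricts on `S` to the
largest ultrametric below `d` (more precisely, to the ultrametric of single linkage).

The field `ahead` is what makes the update `u v' x = max (u v x) w` correct.  The field `largest`
compares `u` with pseudo-ultrametrics `ν` on a subset `L` that is, as far as single linkage is
concerned, isolated from its complement. -/
structure PrimInvariant (n : ℕ) (d : ℕ → ℕ → ℝ) (S : Finset ℕ) (v : ℕ) (u : ℕ → ℕ → ℝ) :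
    Prop where
  self : ∀ x ∈ S, u x x = 0
  symm : ∀ x ∈ S, ∀ y ∈ S, u x y = u y x
  ultra : ∀ x ∈ S, ∀ y ∈ S, ∀ z ∈ S, u x z ≤ max (u x y) (u y z)
  le : ∀ x ∈ S, ∀ y ∈ S, u x y ≤ d x y
  pos : ∀ x ∈ S, ∀ y ∈ S, x ≠ y → 0 < u x y
  last_mem : S.Nonempty → v ∈ S
  ahead : ∀ x ∈ S, ∀ b < n, b ∉ S → u v x ≤ d x b
  largest : ∀ (L : Set ℕ) (ν : ℕ → ℕ → ℝ) (χ : ℝ), IsPseudoUltrametric ν →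
    (∀ x ∈ L, ∀ y ∈ L, ν x y ≤ d x y + χ) →
    (∀ x ∈ L, ∀ y ∈ L, ∀ p < n, p ∉ L → d x y ≤ d p x) →
    ∀ x ∈ S, x ∈ L → ∀ y ∈ S, y ∈ L → ν x y ≤ u x y + χ

theorem PrimInvariant.empty (n : ℕ) (d : ℕ → ℕ → ℝ) (v : ℕ) (u : ℕ → ℕ → ℝ) :
    PrimInvariant n d ∅ v u := by
  constructor <;> simp

/-- One step of Prim's algorithm: a point `v'` at the smallest distance `w` from `S` is reached. -/
theorem PrimInvariant.insert {n : ℕ} {d : ℕ → ℕ → ℝ} {S : Finset ℕ} {v : ℕ} {u : ℕ → ℕ → ℝ}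
    (h : PrimInvariant n d S v u)
    (hself : ∀ x < n, d x x = 0) (hsymm : ∀ x < n, ∀ y < n, d x y = d y x)
    (hpos : ∀ x < n, ∀ y < n, x ≠ y → 0 < d x y)
    (hS : ∀ x ∈ S, x < n) {v' : ℕ} (hv' : v' < n) (hv'S : v' ∉ S) {w : ℝ}
    (hatt : S.Nonempty → ∃ p ∈ S, w = d p v')
    (hmin : ∀ x ∈ S, ∀ b < n, b ∉ S → w ≤ d x b)
    {u' : ℕ → ℕ → ℝ} (hold : ∀ x ∈ S, ∀ y ∈ S, u' x y = u x y)
    (hnew : ∀ x ∈ S, u' v' x = max (u v x) w) (hnew' : ∀ x ∈ S, u' x v' = max (u v x) w)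
    (hdiag : u' v' v' = 0) :
    PrimInvariant n d (insert v' S) v' u' := by
  have hnonneg : ∀ x < n, ∀ y < n, 0 ≤ d x y := fun x hx y hy => by
    by_cases hxy : x = y
    · rw [hxy, hself y hy]
    · exact (hpos x hx y hy hxy).le
  have hne : ∀ x ∈ S, x ≠ v' := fun x hx hxv => hv'S (hxv ▸ hx)
  have hv : ∀ x ∈ S, v ∈ S := fun x hx => h.last_mem ⟨x, hx⟩
  have hw : ∀ x ∈ S, 0 < w := fun x hx => by
    obtain ⟨p, hp, rfl⟩ := hatt ⟨x, hx⟩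
    exact hpos p (hS p hp) v' hv' (hne p hp)
  have hu : ∀ x ∈ S, ∀ y ∈ S, 0 ≤ u x y := fun x hx y hy => by
    by_cases hxy : x = y
    · rw [hxy, h.self y hy]
    · exact (h.pos x hx y hy hxy).le
  constructor
  · simp only [Finset.forall_mem_insert]
    exact ⟨hdiag, fun x hx => by rw [hold x hx x hx, h.self x hx]⟩
  · simp only [Finset.forall_mem_insert]
    refine ⟨⟨trivial, fun x hx => by rw [hnew x hx, hnew' x hx]⟩, fun x hx =>
      ⟨by rw [hnew x hx, hnew' x hx], fun y hy => by rw [hold x hx y hy, hold y hy x hx, h.symm x hx y hy]⟩⟩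
  · simp only [Finset.forall_mem_insert]
    refine ⟨⟨⟨by simp [hdiag], fun z hz => by simp [hdiag]⟩, fun y hy => ⟨?_, fun z hz => ?_⟩⟩,
      fun x hx => ⟨⟨by simp [hdiag], fun z hz => ?_⟩, fun y hy => ⟨?_, fun z hz => ?_⟩⟩⟩
    · rw [hdiag, hnew y hy]
      exact le_max_of_le_left (le_max_of_le_right (hw y hy).le)
    · rw [hnew z hz, hnew y hy, hold y hy z hz]
      have := h.ultra v (hv y hy) y hy z hz
      grind
    · rw [hold x hx z hz, hnew' x hx, hnew z hz]
      have := h.ultra x hx v (hv x hx) z hz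
      have := h.symm x hx v (hv x hx)
      grind
    · rw [hnew' x hx, hnew' y hy, hold x hx y hy]
      have := h.ultra v (hv x hx) y hy x hx
      have := h.symm x hx y hy
      grind
    · rw [hold x hx z hz, hold x hx y hy, hold y hy z hz]
      exact h.ultra x hx y hy z hz
  · have key : ∀ x ∈ S, max (u v x) w ≤ d x v' := fun x hx =>
      max_le (h.ahead x hx v' hv' hv'S) (hmin x hx v' hv' hv'S)
    simp only [Finset.forall_mem_insert]
    refine ⟨⟨by rw [hdiag, hself v' hv'], fun y hy => ?_⟩, fun x hx => ⟨?_, fun y hy => ?_⟩⟩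
    · rw [hnew y hy, hsymm v' hv' y (hS y hy)]
      exact key y hy
    · rw [hnew' x hx]
      exact key x hx
    · rw [hold x hx y hy]
      exact h.le x hx y hy
  · simp only [Finset.forall_mem_insert]
    refine ⟨⟨by simp, fun y hy _ => ?_⟩, fun x hx => ⟨fun _ => ?_, fun y hy hxy => ?_⟩⟩
    · rw [hnew y hy]
      exact lt_max_of_lt_right (hw y hy)
    · rw [hnew' x hx]
      exact lt_max_of_lt_right (hw x hx)
    · rw [hold x hx y hy]
      exact h.pos x hx y hy hxy
  · simp
  · simp only [Finset.mem_insert, not_or]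
    rintro x (hx | hx) b hb hbS
    · rw [hx, hdiag]
      exact hnonneg v' hv' b hb
    · rw [hnew x hx]
      exact max_le (h.ahead x hx b hb hbS.2) (hmin x hx b hb hbS.2)
  · intro L ν χ hν hle hsep
    have key : v' ∈ L → ∀ x ∈ S, x ∈ L → ν v' x ≤ max (u v x) w + χ := by
      intro hvL x hx hxL
      obtain ⟨p, hp, hwp⟩ := hatt ⟨x, hx⟩
      by_cases hpL : p ∈ L
      · -- the detour over `p` costs nothing, because `u v p ≤ d p v' = w`
        have h1 := hν.ultra v' p x
        have h2 := hle p hpL v' hvL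
        have h3 := h.largest L ν χ hν hle hsep p hp hpL x hx hxL
        have h4 := h.ultra p hp v (hv x hx) x hx
        have h5 := h.ahead p hp v' hv' hv'S
        rw [h.symm v (hv x hx) p hp] at h5
        rw [hν.symm p v'] at h2
        grind
      · have h1 := hsep v' hvL x hxL p (hS p hp) hpL
        have h2 := hle v' hvL x hxL
        have := le_max_right (u v x) w
        linarith
    simp only [Finset.forall_mem_insert]
    refine ⟨fun hvL => ⟨fun _ => ?_, fun y hy hyL => ?_⟩, fun x hx hxL =>
      ⟨fun hvL => ?_, fun y hy hyL => ?_⟩⟩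
    · rw [hdiag, ← hself v' hv']
      exact hle v' hvL v' hvL
    · rw [hnew y hy]
      exact key hvL y hy hyL
    · rw [hnew' x hx, hν.symm]
      exact key hvL x hx hxL
    · rw [hold x hx y hy]
      exact h.largest L ν χ hν hle hsep x hx hxL y hy hyL

/-! ### The nearest ultrametric -/

theorem LInf_le_iff {α : Type*} [Finite α] [Nonempty α] {μ ν : α → α → ℝ} {r : ℝ} :
    LInf μ ν ≤ r ↔ ∀ x y, |μ x y - ν x y| ≤ r := by
  unfold LInf
  rw [ciSup_le_iff (Set.finite_range _).bddAbove]
  exact ⟨fun h x y => h (x, y), fun h q => h q.1 q.2⟩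

/-- The largest ultrametric `u` below `d`, raised off the diagonal by half of the largest defect
`d - u`, is an ultrametric. -/
theorem isUltrametric_shift {α : Type*} {u : α → α → ℝ} {ε : ℝ} (hε : 0 ≤ ε)
    (hself : ∀ x, u x x = 0) (hsymm : ∀ x y, u x y = u y x)
    (hultra : ∀ x y z, u x z ≤ max (u x y) (u y z)) (hpos : ∀ x y, x ≠ y → 0 < u x y)
    {μ : α → α → ℝ} (hμ : ∀ x, μ x x = 0) (hμ' : ∀ x y, x ≠ y → μ x y = u x y + ε) :
    IsUltrametric μ where
  nonneg x y := by
    by_cases h : x = y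
    · rw [h, hμ]
    · rw [hμ' x y h]
      linarith [hpos x y h]
  self := hμ
  symm x y := by
    by_cases h : x = y
    · rw [h]
    · rw [hμ' x y h, hμ' y x (Ne.symm h), hsymm]
  ultra x y z := by
    by_cases hxy : x = y
    · rw [hxy]
      exact le_max_right _ _
    by_cases hyz : y = z
    · rw [hyz]
      exact le_max_left _ _
    rw [hμ' x y hxy, hμ' y z hyz]
    by_cases hxz : x = z
    · rw [hxz, hμ]
      exact le_max_of_le_right (by linarith [hpos y z hyz])
    · rw [hμ' x z hxz]
      have := hultra x y z
      grind
  eq_of_zero x y h := by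
    by_contra hxy
    rw [hμ' x y hxy] at h
    linarith [hpos x y hxy]

/-- The same function is nearest to `d`: a pseudo-ultrametric `ν` with `|d - ν| ≤ χ` satisfies
`d - χ ≤ ν ≤ u + χ`, so that every defect `d - u` is at most `2 χ`. -/
theorem LInf_shift_le {α : Type*} [Finite α] [Nonempty α] {d u : α → α → ℝ} {E : ℝ}
    (hd : ∀ x, d x x = 0) (hle : ∀ x y, u x y ≤ d x y)
    (hE : ∀ x y, d x y - u x y ≤ E) (hatt : E = 0 ∨ ∃ x y, E = d x y - u x y)
    {μ : α → α → ℝ} (hμ : ∀ x, μ x x = 0) (hμ' : ∀ x y, x ≠ y → μ x y = u x y + E * (1 / 2))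
    {ν : α → α → ℝ}
    (hν : ∀ χ, (∀ x y, ν x y ≤ d x y + χ) → ∀ x y, ν x y ≤ u x y + χ) :
    LInf d μ ≤ LInf d ν := by
  have h := (LInf_le_iff (μ := d) (ν := ν)).1 le_rfl
  have hmax := hν (LInf d ν) fun x y => by linarith [(abs_le.1 (h x y)).1]
  have h0 : 0 ≤ LInf d ν := (abs_nonneg _).trans (h (Classical.arbitrary α) (Classical.arbitrary α))
  have hEν : E ≤ 2 * LInf d ν := by
    rcases hatt with h' | ⟨x, y, h'⟩
    · linarith
    · linarith [hmax x y, (abs_le.1 (h x y)).2]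
  rw [LInf_le_iff]
  intro x y
  by_cases hxy : x = y
  · rw [hxy, hd, hμ]
    simpa using h0
  · rw [hμ' x y hxy, abs_le]
    constructor <;> linarith [hE x y, hle x y]

/-! ### The program

The points are numbered from `0` to `n - 1`.  All parts of the program use the following storage.

* Natural-number registers: `1` holds the number `1`, `2` holds `n`, and `3` the number of levels;
  `4` and `5` are the counters of the outer and the inner loop; `10` is the address of a row, and
  `14` that of a matrix entry; `7` and `11` hold levels of points that are to be compared; `12` and
  `13` hold the points reached next and last by Prim's algorithm.
* Real registers: `1` holds the bound of the distances, `2` and `3` the candidates for an extremum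
  and the values they are compared with.
* Natural-number arrays: `0` input, `1` output relation, `2`, `3` and `5` tables of levels, rows and
  levels plus one, `4` marks of the points reached by Prim's algorithm.
* Real arrays: `0` input, `1` output distances, `3` keys of Prim's algorithm, `4` defects and `5`
  Hausdorff distances. -/

/-- Count the points: register `2` becomes the sum of the cardinalities of the levels, register `3`
the number of levels and register `1` the number `1`. -/
def sizeProg : Program :=
  .seq (block [.nconst 1 1, .nconst 9 0, .nload 3 0 9, .nconst 2 0]) <|
  forLoop 4 3 (block [.nadd 9 4 1, .nload 9 0 9, .nadd 2 2 9])

/-- Tables indexed by the points: array `2` holds the level of a point, array `5` the same number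
plus one, and array `3` the address of the row of the point in an `n × n` matrix.  Register `6`
becomes `n * n`.  Registers `7` and `8` hold the current level and its end. -/
def tableProg : Program :=
  .seq (block [.nconst 7 0, .nload 8 0 1, .nconst 6 0]) <|
  forLoop 4 2 <|
  .seq (.ite (.nle 8 4) (block [.nadd 7 7 1, .nadd 9 7 1, .nload 9 0 9, .nadd 8 8 9]) .skip) <|
  block [.nstore 2 4 7, .nadd 9 7 1, .nstore 5 4 9, .nstore 3 4 6, .nadd 6 6 2]

/-- Real register `1` becomes an upper bound of all distances.  It is at least `1`, so that it is
positive also if all distances are `0`. -/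
def boundProg : Program :=
  .seq (block [.rconst 1 1]) <|
  forLoop 4 6 <|
  .seq (block [.rload 3 0 4]) (.ite (.rlt 1 3) (block [.rmove 1 3]) .skip)

/-- Initialize the keys (real array `3`) of Prim's algorithm. -/
def keyProg : Program := forLoop 4 2 (block [.rstore 3 4 1])

/-- Select a point with smallest key that has not been reached: its number goes to register `12`,
its key to real register `2`.  The search starts from the bound of the distances; the comparison is
not strict, because keys may be equal to this bound. -/
def selectProg : Program :=
  .seq (block [.rmove 2 1]) <|
  forLoop 5 2 <|
  .seq (block [.nload 9 4 5, .rload 3 3 5]) <|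
  .ite (.nlt 9 1) (.ite (.rle 3 2) (block [.nmove 12 5, .rmove 2 3]) .skip) .skip

/-- Extend the ultrametric (real array `1`) from the reached points to the selected one, and mark
this point (in array `4`) as reached.  Register `13` holds the point reached last. -/
def extendProg : Program :=
  .seq (block [.nload 10 3 12, .nload 11 3 13]) <|
  .seq (forLoop 5 2 <|
    .seq (block [.nload 9 4 5]) <|
    .ite (.nle 1 9)
      (.seq (block [.nadd 14 11 5, .rload 3 1 14]) <|
        .seq (.ite (.rlt 3 2) (block [.rmove 3 2]) .skip) <|
        block [.nadd 14 10 5, .rstore 1 14 3, .nload 15 3 5, .nadd 15 15 12, .rstore 1 15 3])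
      .skip) <|
  block [.nadd 14 10 12, .rconst 3 0, .rstore 1 14 3, .nstore 4 12 1, .nmove 13 12]

/-- Lower the keys to the distances from the selected point.  Points of different levels are
treated as if their distance were the bound in real register `1`. -/
def relaxProg : Program :=
  .seq (block [.nload 10 3 12, .nload 7 2 12]) <|
  forLoop 5 2 <|
  .seq (block [.nload 11 2 5]) <|
  .seq (ifEq 7 11 (block [.nadd 14 10 5, .rload 3 0 14]) (block [.rmove 3 1])) <|
  .seq (block [.rload 4 3 5]) (.ite (.rle 3 4) (block [.rstore 3 5 3]) .skip)

/-- Prim's algorithm. -/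
def primProg : Program :=
  .seq keyProg (forLoop 4 2 (.seq selectProg (.seq extendProg relaxProg)))

/-- Real array `4` receives, for every level, the largest defect of the ultrametric. -/
def defectProg : Program :=
  forLoop 4 2 <|
  .seq (block [.nload 10 3 4, .nload 7 2 4]) <|
  forLoop 5 2 <|
  .seq (block [.nload 11 2 5]) <|
  ifEq 7 11
    (.seq (block [.nadd 14 10 5, .rload 3 0 14, .rload 4 1 14, .rsub 3 3 4, .rload 4 4 7])
      (.ite (.rlt 4 3) (block [.rstore 4 7 3]) .skip))
    .skip

/-- Raise the ultrametric off the diagonal by half of the defect of the level. -/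
def shiftProg : Program :=
  .seq (block [.rconst 5 (1 / 2)]) <|
  forLoop 4 2 <|
  .seq (block [.nload 10 3 4, .nload 7 2 4, .rload 2 4 7, .rmul 2 2 5]) <|
  forLoop 5 2 <|
  ifEq 4 5 .skip (block [.nadd 14 10 5, .rload 3 1 14, .radd 3 3 2, .rstore 1 14 3])

/-- Directed Hausdorff distances.  With arrays `A` and `B` describing functions `f` and `g` on the
points, entry `l` of real array `5` is raised to the largest distance of a point `a` with `f a = l`
from the set of all points `b` with `g b = l`. -/
def hausdorffProg (A B : ℕ) : Program :=
  forLoop 4 2 <|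
  .seq (block [.nload 10 3 4, .nload 7 A 4, .rmove 2 1]) <|
  .seq (forLoop 5 2 <|
    .seq (block [.nload 11 B 5]) <|
    ifEq 7 11
      (.seq (block [.nadd 14 10 5, .rload 3 0 14]) (.ite (.rlt 3 2) (block [.rmove 2 3]) .skip))
      .skip) <|
  .seq (block [.rload 3 5 7]) (.ite (.rlt 3 2) (block [.rstore 5 7 2]) .skip)

/-- Mark, in array `1`, the pairs of points of successive levels within the Hausdorff distance. -/
def relProg : Program :=
  forLoop 4 2 <|
  .seq (block [.nload 10 3 4, .nload 7 5 4, .rload 2 5 7]) <|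
  forLoop 5 2 <|
  .seq (block [.nload 11 2 5]) <|
  ifEq 7 11
    (.seq (block [.nadd 14 10 5, .rload 3 0 14]) (.ite (.rle 3 2) (block [.nstore 1 14 1]) .skip))
    .skip

/-- The whole algorithm. -/
def clusterProg : Program :=
  .seq sizeProg <| .seq tableProg <| .seq boundProg <| .seq primProg <| .seq defectProg <|
  .seq shiftProg <| .seq (hausdorffProg 5 2) <| .seq (hausdorffProg 2 5) relProg

/-! ### Correctness of the parts -/

attribute [local simp] block Program.eval eval_ifEq Instr.apply Test.Holds State.setN State.setR
  State.writeN State.writeR Function.update_apply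

/-- The part of the configuration that is fixed once the tables have been computed. -/
structure Context (n : ℕ) (lev : ℕ → ℕ) (D : ℕ → ℕ → ℝ) (s : State) : Prop where
  one : s.nreg 1 = 1
  size : s.nreg 2 = n
  level : ∀ a < n, s.narr 2 a = lev a
  level_succ : ∀ a < n, s.narr 5 a = lev a + 1
  row : ∀ a < n, s.narr 3 a = a * n
  dist : ∀ a < n, ∀ b < n, s.rarr 0 (a * n + b) = D a b

theorem Context.frame {n : ℕ} {lev : ℕ → ℕ} {D : ℕ → ℕ → ℝ} {s s' : State} {p : Program}
    (h : Context n lev D s) (hF : Frame p s s')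
    (hp : (p.any (·.wN 1) || p.any (·.wN 2) || p.any (·.wNA 2) || p.any (·.wNA 5) ||
      p.any (·.wNA 3) || p.any (·.wRA 0)) = false) : Context n lev D s' := by
  simp only [Bool.or_eq_false_iff] at hp
  obtain ⟨⟨⟨⟨⟨h1, h2⟩, h3⟩, h4⟩, h5⟩, h6⟩ := hp
  constructor
  · rw [hF.nreg 1 h1, h.one]
  · rw [hF.nreg 2 h2, h.size]
  · rw [hF.narr 2 h3]
    exact h.level
  · rw [hF.narr 5 h4]
    exact h.level_succ
  · rw [hF.narr 3 h5]
    exact h.row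
  · rw [hF.rarr 0 h6]
    exact h.dist

theorem address_inj {n a b a' b' : ℕ} (hb : b < n) (hb' : b' < n) :
    a * n + b = a' * n + b' ↔ a = a' ∧ b = b' := by
  refine ⟨fun h => ?_, fun ⟨h, h'⟩ => by rw [h, h']⟩
  have ha : a = a' := by
    have h1 := congrArg (· / n) h
    simpa [Nat.add_div_of_dvd_right (Nat.dvd_mul_left n _), Nat.div_eq_of_lt hb,
      Nat.div_eq_of_lt hb', Nat.mul_div_cancel _ (Nat.zero_lt_of_lt hb)] using h1
  subst ha
  exact ⟨rfl, by omega⟩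

theorem sizeProg_spec {T : ℕ} {card : ℕ → ℕ} {s : State} (hT : s.narr 0 0 = T)
    (hc : ∀ i < T, s.narr 0 (i + 1) = card i) :
    Terminates sizeProg s (4 + (T * (3 + 2) + 2)) fun s' =>
      s'.nreg 1 = 1 ∧ s'.nreg 2 = ∑ i ∈ Finset.range T, card i := by
  refine Terminates.seq (R := fun s' => s'.nreg 1 = 1 ∧ s'.nreg 2 = 0 ∧ s'.nreg 3 = T)
    (Terminates.of_eval rfl (by simp [hT])) fun s₁ hF ⟨h1, h2, h3⟩ => ?_
  refine (Terminates.forLoop (N := T) (fun k s' => s'.nreg 2 = ∑ i ∈ Finset.range k, card i) h3 h1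
    rfl rfl rfl (by decide) (by decide) ?_ ?_).mono le_rfl ?_
  · simp [h2]
  · intro k s₂ hk hk4 hF₂ hI
    refine Terminates.of_eval rfl ?_
    have e1 := hF₂.nreg 1 rfl
    have e0 : s₂.narr 0 = s.narr 0 := (hF₂.narr 0 rfl).trans (hF.narr 0 rfl)
    simp [e1, h1, hk4, e0, hc k hk, hI, Finset.sum_range_succ]
  · intro s' hF' h
    exact ⟨(hF'.nreg 1 rfl).trans h1, h⟩

theorem monotone_sum_range (card : ℕ → ℕ) :
    Monotone fun l => ∑ i ∈ Finset.range l, card i :=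
  fun _ _ h => Finset.sum_le_sum_of_subset (Finset.range_mono h)

/-- The level of a point is determined by the partial sums of the cardinalities. -/
theorem eq_of_sum_range_le_lt {card : ℕ → ℕ} {l l' a : ℕ}
    (h : ∑ i ∈ Finset.range l, card i ≤ a) (h' : a < ∑ i ∈ Finset.range (l + 1), card i)
    (k : ∑ i ∈ Finset.range l', card i ≤ a) (k' : a < ∑ i ∈ Finset.range (l' + 1), card i) :
    l = l' := by
  have h1 := (monotone_sum_range card).reflect_lt (k.trans_lt h')
  have h2 := (monotone_sum_range card).reflect_lt (h.trans_lt k')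
  omega

theorem tableProg_spec {T n : ℕ} {card lev : ℕ → ℕ} {s : State} (hT : 0 < T)
    (hc : ∀ i < T, s.narr 0 (i + 1) = card i) (hpos : ∀ i < T, 0 < card i)
    (h1 : s.nreg 1 = 1) (h2 : s.nreg 2 = n) (hn : n = ∑ i ∈ Finset.range T, card i)
    (hlev : ∀ a < n, ∑ i ∈ Finset.range (lev a), card i ≤ a ∧
      a < ∑ i ∈ Finset.range (lev a + 1), card i) :
    Terminates tableProg s (3 + (n * (10 + 2) + 2)) fun s' => s'.nreg 6 = n * n ∧
      ∀ a < n, s'.narr 2 a = lev a ∧ s'.narr 5 a = lev a + 1 ∧ s'.narr 3 a = a * n := by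
  refine Terminates.seq (R := fun s' => s'.nreg 7 = 0 ∧ s'.nreg 8 = card 0 ∧ s'.nreg 6 = 0)
    (Terminates.of_eval rfl (by simp [h1, ← hc 0 hT])) fun s₁ hF ⟨h7, h8, h6⟩ => ?_
  have k1 := hF.nreg 1 rfl
  have k2 := hF.nreg 2 rfl
  have k0 := hF.narr 0 rfl
  refine (Terminates.forLoop (N := n) (fun k s' => s'.nreg 6 = k * n ∧
    (∃ l < T, s'.nreg 7 = l ∧ s'.nreg 8 = ∑ i ∈ Finset.range (l + 1), card i ∧
      ∑ i ∈ Finset.range l, card i ≤ k ∧ k ≤ ∑ i ∈ Finset.range (l + 1), card i) ∧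
    ∀ a < k, s'.narr 2 a = lev a ∧ s'.narr 5 a = lev a + 1 ∧ s'.narr 3 a = a * n)
    (k2.trans h2) (k1.trans h1) rfl rfl rfl (by decide) (by decide) ?_ ?_).mono le_rfl ?_
  · refine ⟨by simp [h6], ⟨0, hT, ?_⟩, by simp⟩
    simp [h7, h8]
  · rintro k s₂ hk hk4 hF₂ ⟨h6', ⟨l, hlT, h7', h8', hl, hl'⟩, hA⟩
    have e1 : s₂.nreg 1 = 1 := by rw [hF₂.nreg 1 rfl, k1, h1]
    have e2 : s₂.nreg 2 = n := by rw [hF₂.nreg 2 rfl, k2, h2]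
    have e0 : s₂.narr 0 = s.narr 0 := by rw [hF₂.narr 0 rfl, k0]
    refine Terminates.of_eval rfl ?_
    obtain ⟨ha, hb⟩ := hlev k hk
    by_cases h : ∑ i ∈ Finset.range (l + 1), card i ≤ k
    · have hlt : l + 1 < T := (monotone_sum_range card).reflect_lt (by
        change ∑ i ∈ Finset.range (l + 1), card i < ∑ i ∈ Finset.range T, card i
        omega)
      have hp := hpos (l + 1) hlt
      have hs := Finset.sum_range_succ card (l + 1)
      have hL : l + 1 = lev k := eq_of_sum_range_le_lt h (by omega) ha hb
      refine ⟨?_, ⟨l + 1, hlt, ?_⟩, ?_⟩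
      · simp [h6', e2, h8', hk4, h, Nat.add_one_mul]
      · simp [h8', hk4, h, h7', e1, e0, hc _ hlt]
        omega
      · intro a hak
        rcases Nat.lt_succ_iff_lt_or_eq.1 hak with hak | rfl
        · simpa [h8', hk4, h, hak.ne] using hA a hak
        · simp [h8', hk4, h, h7', e1, h6']
          omega
    · have hL : l = lev k := eq_of_sum_range_le_lt hl (by omega) ha hb
      refine ⟨?_, ⟨l, hlT, ?_⟩, ?_⟩
      · simp [h6', e2, h8', hk4, h, Nat.add_one_mul]
      · simp [h8', hk4, h, h7']
        omega
      · intro a hak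
        rcases Nat.lt_succ_iff_lt_or_eq.1 hak with hak | rfl
        · simpa [h8', hk4, h, hak.ne] using hA a hak
        · simp [h8', hk4, h, h7', e1, h6']
          omega
  · exact fun s' _ h => ⟨h.1, h.2.2⟩

theorem boundProg_spec {N : ℕ} {s : State} (h1 : s.nreg 1 = 1) (h6 : s.nreg 6 = N) :
    Terminates boundProg s (1 + (N * (3 + 2) + 2)) fun s' =>
      1 ≤ s'.rreg 1 ∧ ∀ q < N, s.rarr 0 q ≤ s'.rreg 1 := by
  refine Terminates.seq (R := fun s' => s'.rreg 1 = 1)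
    (Terminates.of_eval rfl (by simp)) fun s₁ hF hr => ?_
  refine (Terminates.forLoop (N := N) (fun k s' => 1 ≤ s'.rreg 1 ∧
    ∀ q < k, s.rarr 0 q ≤ s'.rreg 1) ((hF.nreg 6 rfl).trans h6) ((hF.nreg 1 rfl).trans h1)
    rfl rfl rfl (by decide) (by decide) ?_ ?_)
  · simp [hr]
  · rintro k s₂ hk hk4 hF₂ ⟨hI, hJ⟩
    have e0 : s₂.rarr 0 = s.rarr 0 := by rw [hF₂.rarr 0 rfl, hF.rarr 0 rfl]
    refine Terminates.of_eval rfl ?_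
    by_cases h : s₂.rreg 1 < s.rarr 0 k
    · simp [hk4, e0, h]
      refine ⟨by linarith, fun q hq => ?_⟩
      rcases Nat.lt_or_eq_of_le hq with hq | rfl
      · exact (hJ q hq).trans h.le
      · exact le_rfl
    · simp [hk4, e0, h, hI]
      intro q hq
      rcases Nat.lt_or_eq_of_le hq with hq | rfl
      · exact hJ q hq
      · exact not_lt.1 h

theorem relProg_spec {n : ℕ} {lev : ℕ → ℕ} {D : ℕ → ℕ → ℝ} {s : State}
    (hs : Context n lev D s) (h0 : s.narr 1 = fun _ => 0) :
    Terminates relProg s (n * (3 + (n * (7 + 2) + 2) + 2) + 2) fun s' => ∀ a < n, ∀ b < n,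
      s'.narr 1 (a * n + b) = 1 ↔ lev b = lev a + 1 ∧ D a b ≤ s.rarr 5 (lev a + 1) := by
  refine (Terminates.forLoop (N := n) (fun k s' => ∀ a < n, ∀ b < n, s'.narr 1 (a * n + b) = 1 ↔
    a < k ∧ lev b = lev a + 1 ∧ D a b ≤ s.rarr 5 (lev a + 1)) hs.size hs.one rfl rfl rfl
    (by decide) (by decide) ?_ ?_).mono le_rfl ?_
  · simp [h0]
  · intro k s₁ hk hk1 hF hI
    have hs₁ := hs.frame hF rfl
    have h5 := hF.rarr 5 rfl
    refine Terminates.seq (R := fun s' => s'.nreg 10 = k * n ∧ s'.nreg 7 = lev k + 1 ∧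
      s'.rreg 2 = s.rarr 5 (lev k + 1)) (Terminates.of_eval rfl ?_)
      fun s₂ hF₂ ⟨h10, h7, h2⟩ => ?_
    · simp [hk1, hs₁.row k hk, hs₁.level_succ k hk, h5]
    have hs₂ := hs₁.frame hF₂ rfl
    refine (Terminates.forLoop (N := n) (fun j s' => ∀ a < n, ∀ b < n,
      s'.narr 1 (a * n + b) = 1 ↔
        (a < k ∨ a = k ∧ b < j) ∧ lev b = lev a + 1 ∧ D a b ≤ s.rarr 5 (lev a + 1)) hs₂.size
        hs₂.one rfl rfl rfl (by decide) (by decide) ?_ ?_).mono le_rfl ?_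
    · simpa [hF₂.narr 1 rfl] using hI
    · intro j s₃ hj hj1 hF₃ hJ
      have hs₃ := hs₂.frame hF₃ rfl
      have e10 := hF₃.nreg 10 rfl
      have e7 := hF₃.nreg 7 rfl
      have e2 := hF₃.rreg 2 rfl
      refine Terminates.of_eval rfl ?_
      intro a ha b hb
      have hab := hJ a ha b hb
      simp [e10, e7, e2, h10, h7, h2, hj1, hs₃.level j hj, hs₃.dist k hk j hj, hs₃.one]
      split_ifs <;> simp [address_inj hb hj] <;> grind
    · intro s' _ h a ha b hb
      rw [State.setN, h a ha b hb]
      grind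
  · intro s' _ h a ha b hb
    rw [h a ha b hb]
    tauto

/-- The second and the third conclusion together determine the new entries: they exceed the old
ones only as far as the directed Hausdorff distances require. -/
theorem hausdorffProg_spec {A B n : ℕ} (hA : A = 2 ∨ A = 5) (hB : B = 2 ∨ B = 5)
    {lev f g : ℕ → ℕ} {D : ℕ → ℕ → ℝ} {s : State} (hs : Context n lev D s)
    (hf : ∀ a < n, s.narr A a = f a) (hg : ∀ a < n, s.narr B a = g a)
    (hD : ∀ a < n, ∀ b < n, D a b ≤ s.rreg 1) :
    Terminates (hausdorffProg A B) s (n * (3 + (n * (7 + 2) + 2 + 3) + 2) + 2) fun s' =>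
      (∀ l, s.rarr 5 l ≤ s'.rarr 5 l) ∧
      (∀ a < n, (∃ b < n, g b = f a) → ∃ b < n, g b = f a ∧ D a b ≤ s'.rarr 5 (f a)) ∧
      ∀ l r, s.rarr 5 l ≤ r → (∀ a < n, f a = l → ∃ b < n, g b = l ∧ D a b ≤ r) →
        s'.rarr 5 l ≤ r := by
  refine (Terminates.forLoop (N := n) (fun k s' => (∀ l, s.rarr 5 l ≤ s'.rarr 5 l) ∧
      (∀ a < k, (∃ b < n, g b = f a) → ∃ b < n, g b = f a ∧ D a b ≤ s'.rarr 5 (f a)) ∧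
      ∀ l r, s.rarr 5 l ≤ r → (∀ a < n, f a = l → ∃ b < n, g b = l ∧ D a b ≤ r) →
        s'.rarr 5 l ≤ r) hs.size hs.one (by rfl) (by rfl) (by rfl)
    (by decide) (by decide) ?_ ?_)
  · exact ⟨fun _ => le_rfl, fun _ h => absurd h (Nat.not_lt_zero _), fun _ _ h _ => h⟩
  rintro k s₁ hk hk1 hF ⟨hI₁, hI₂, hI₃⟩
  have hs₁ := hs.frame hF rfl
  have h1 := hF.rreg 1 rfl
  have hA₁ : s₁.narr A = s.narr A := hF.narr A (by rcases hA with rfl | rfl <;> rfl)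
  have hB₁ : s₁.narr B = s.narr B := hF.narr B (by rcases hB with rfl | rfl <;> rfl)
  refine Terminates.seq (R := fun s' => s'.nreg 10 = k * n ∧ s'.nreg 7 = f k ∧
      s'.rreg 2 = s.rreg 1) (Terminates.of_eval rfl ?_) fun s₂ hF₂ ⟨h10, h7, h2⟩ => ?_
  · simp [hk1, hs₁.row k hk, hA₁, hf k hk, h1]
  have hs₂ := hs₁.frame hF₂ rfl
  refine Terminates.seq (R := fun s' => (∀ b < n, g b = f k → s'.rreg 2 ≤ D k b) ∧
    (s'.rreg 2 = s.rreg 1 ∨ ∃ b < n, g b = f k ∧ s'.rreg 2 = D k b))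
    (Terminates.forLoop (N := n) (fun j s' => (∀ b < j, g b = f k → s'.rreg 2 ≤ D k b) ∧
    (s'.rreg 2 = s.rreg 1 ∨ ∃ b < n, g b = f k ∧ s'.rreg 2 = D k b)) hs₂.size hs₂.one rfl rfl rfl
    (by decide) (by decide) ?_ ?_) ?_
  · simp [h2]
  · rintro j s₃ hj hj1 hF₃ ⟨hJ₁, hJ₂⟩
    have hs₃ := hs₂.frame hF₃ rfl
    have e10 := hF₃.nreg 10 rfl
    have e7 := hF₃.nreg 7 rfl
    have hB₃ : s₃.narr B = s.narr B := by rw [hF₃.narr B rfl, hF₂.narr B rfl, hB₁]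
    refine Terminates.of_eval rfl ?_
    by_cases h : f k = g j
    · by_cases h' : D k j < s₃.rreg 2
      · simp [e10, e7, h10, h7, hj1, hs₃.dist k hk j hj, hB₃, hg j hj, h, h']
        refine ⟨fun b hb hgb => ?_, Or.inr ⟨j, hj, rfl, rfl⟩⟩
        rcases Nat.lt_or_eq_of_le hb with hb | rfl
        · exact h'.le.trans (hJ₁ b hb (hgb.trans h.symm))
        · exact le_rfl
      · simp [e10, e7, h10, h7, hj1, hs₃.dist k hk j hj, hB₃, hg j hj, h, h']
        refine ⟨fun b hb hgb => ?_, by rwa [h] at hJ₂⟩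
        rcases Nat.lt_or_eq_of_le hb with hb | rfl
        · exact hJ₁ b hb (hgb.trans h.symm)
        · exact not_lt.1 h'
    · simp [e7, h7, hj1, hB₃, hg j hj, h]
      refine ⟨fun b hb hgb => ?_, hJ₂⟩
      rcases Nat.lt_or_eq_of_le hb with hb | rfl
      · exact hJ₁ b hb hgb
      · exact absurd hgb.symm h
  · intro s₃ hF₃ ⟨hJ₁, hJ₂⟩
    have e7 : s₃.nreg 7 = f k := by rw [hF₃.nreg 7 rfl, h7]
    have e5 : s₃.rarr 5 = s₁.rarr 5 := by rw [hF₃.rarr 5 rfl, hF₂.rarr 5 rfl]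
    refine Terminates.of_eval rfl ?_
    -- the inner loop has computed the distance of `k` from the points `b` with `g b = f k`
    have hatt : (∃ b < n, g b = f k) → ∃ b < n, g b = f k ∧ D k b ≤ s₃.rreg 2 := by
      rintro ⟨b, hb, hgb⟩
      rcases hJ₂ with h | ⟨b', hb', hgb', h⟩
      · exact ⟨b, hb, hgb, by rw [h]; exact hD k hk b hb⟩
      · exact ⟨b', hb', hgb', h.ge⟩
    have key : ∀ l, ((((Program.seq (block [.rload 3 5 7])
        (.ite (.rlt 3 2) (block [.rstore 5 7 2]) .skip)).eval s₃).rarr 5) l =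
        if l = f k then max (s₁.rarr 5 l) (s₃.rreg 2) else s₁.rarr 5 l) := by
      intro l
      by_cases h : s₁.rarr 5 (f k) < s₃.rreg 2
      · simp [e7, e5, h]
        grind
      · simp [e7, e5, h]
        grind
    simp only [State.setN, key]
    refine ⟨fun l => ?_, fun a ha hex => ?_, fun l r hr hall => ?_⟩
    · split_ifs
      · exact le_max_of_le_left (hI₁ l)
      · exact hI₁ l
    · rcases Nat.lt_succ_iff_lt_or_eq.1 ha with ha | rfl
      · obtain ⟨b, hb, hgb, hab⟩ := hI₂ a ha hex
        refine ⟨b, hb, hgb, ?_⟩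
        split_ifs
        · exact le_max_of_le_left hab
        · exact hab
      · obtain ⟨b, hb, hgb, hab⟩ := hatt hex
        refine ⟨b, hb, hgb, ?_⟩
        rw [if_pos rfl]
        exact le_max_of_le_right hab
    · split_ifs with h
      · refine max_le (hI₃ l r hr hall) ?_
        obtain ⟨b, hb, hgb, hab⟩ := hall k hk h.symm
        exact (hJ₁ b hb (hgb.trans h)).trans hab
      · exact hI₃ l r hr hall

theorem defectProg_spec {n : ℕ} {lev : ℕ → ℕ} {D : ℕ → ℕ → ℝ} {s : State}
    (hs : Context n lev D s) (h0 : s.rarr 4 = fun _ => 0) :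
    Terminates defectProg s (n * (2 + (n * (10 + 2) + 2) + 2) + 2) fun s' =>
      (∀ a < n, ∀ b < n, lev a = lev b → D a b - s.rarr 1 (a * n + b) ≤ s'.rarr 4 (lev a)) ∧
      ∀ l, s'.rarr 4 l = 0 ∨ ∃ a < n, ∃ b < n, lev a = l ∧ lev b = l ∧
        s'.rarr 4 l = D a b - s.rarr 1 (a * n + b) := by
  refine (Terminates.forLoop (N := n) (fun k s' =>
    (∀ a < k, ∀ b < n, lev a = lev b → D a b - s.rarr 1 (a * n + b) ≤ s'.rarr 4 (lev a)) ∧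
      ∀ l, s'.rarr 4 l = 0 ∨ ∃ a < n, ∃ b < n, lev a = l ∧ lev b = l ∧
        s'.rarr 4 l = D a b - s.rarr 1 (a * n + b)) hs.size hs.one rfl rfl rfl
    (by decide) (by decide) ?_ ?_)
  · simp [h0]
  rintro k s₁ hk hk1 hF ⟨hI₁, hI₂⟩
  have hs₁ := hs.frame hF rfl
  refine Terminates.seq (R := fun s' => s'.nreg 10 = k * n ∧ s'.nreg 7 = lev k)
    (Terminates.of_eval rfl ?_) fun s₂ hF₂ ⟨h10, h7⟩ => ?_
  · simp [hk1, hs₁.row k hk, hs₁.level k hk]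
  have hs₂ := hs₁.frame hF₂ rfl
  have h1 : s₂.rarr 1 = s.rarr 1 := by rw [hF₂.rarr 1 rfl, hF.rarr 1 rfl]
  refine (Terminates.forLoop (N := n) (fun j s' =>
    (∀ a < n, ∀ b < n, a < k ∨ a = k ∧ b < j → lev a = lev b →
      D a b - s.rarr 1 (a * n + b) ≤ s'.rarr 4 (lev a)) ∧
      ∀ l, s'.rarr 4 l = 0 ∨ ∃ a < n, ∃ b < n, lev a = l ∧ lev b = l ∧
        s'.rarr 4 l = D a b - s.rarr 1 (a * n + b)) hs₂.size hs₂.one rfl rfl rfl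
    (by decide) (by decide) ?_ ?_).mono le_rfl ?_
  · refine ⟨fun a ha b hb hab => ?_, ?_⟩
    · simpa [hF₂.rarr 4 rfl] using hI₁ a (by omega) b hb
    · simpa [hF₂.rarr 4 rfl] using hI₂
  · rintro j s₃ hj hj1 hF₃ ⟨hJ₁, hJ₂⟩
    have hs₃ := hs₂.frame hF₃ rfl
    have e10 := hF₃.nreg 10 rfl
    have e7 := hF₃.nreg 7 rfl
    have e1 := (hF₃.rarr 1 rfl).trans h1
    refine Terminates.of_eval rfl ?_
    by_cases h : lev k = lev j
    · by_cases h' : s₃.rarr 4 (lev k) < D k j - s.rarr 1 (k * n + j)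
      · simp [e10, e7, h10, h7, hj1, hs₃.level j hj, hs₃.dist k hk j hj, h, e1, h ▸ h']
        refine ⟨fun a ha b hb hab hl => ?_, fun l => ?_⟩
        · by_cases hp : a < k ∨ a = k ∧ b < j
          · have := hJ₁ a ha b hb hp hl
            split_ifs with hlj
            · rw [hlj, ← h] at this
              linarith
            · linarith
          · obtain ⟨rfl, rfl⟩ : a = k ∧ b = j := by omega
            rw [if_pos h]
            linarith
        · split_ifs with hlj
          · exact Or.inr ⟨k, hk, j, hj, by rw [h, hlj], hlj.symm, rfl⟩
          · exact hJ₂ l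
      · simp [e10, e7, h10, h7, hj1, hs₃.level j hj, hs₃.dist k hk j hj, h, e1, h ▸ h']
        refine ⟨fun a ha b hb hab hl => ?_, hJ₂⟩
        by_cases hp : a < k ∨ a = k ∧ b < j
        · linarith [hJ₁ a ha b hb hp hl]
        · obtain ⟨rfl, rfl⟩ : a = k ∧ b = j := by omega
          linarith [not_lt.1 h']
    · simp [e7, h7, hj1, hs₃.level j hj, h]
      refine ⟨fun a ha b hb hab hl => ?_, hJ₂⟩
      by_cases hp : a < k ∨ a = k ∧ b < j
      · linarith [hJ₁ a ha b hb hp hl]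
      · obtain ⟨rfl, rfl⟩ : a = k ∧ b = j := by omega
        exact absurd hl h
  · intro s' _ ⟨h, h'⟩
    exact ⟨fun a ha b hb => h a (by omega) b hb (by omega), h'⟩

theorem shiftProg_spec {n : ℕ} {lev : ℕ → ℕ} {D : ℕ → ℕ → ℝ} {s : State}
    (hs : Context n lev D s) :
    Terminates shiftProg s (1 + (n * (4 + (n * (6 + 2) + 2) + 2) + 2)) fun s' =>
      ∀ a < n, ∀ b < n, s'.rarr 1 (a * n + b) =
        s.rarr 1 (a * n + b) + if a = b then 0 else s.rarr 4 (lev a) * (1 / 2) := by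
  refine Terminates.seq (R := fun s' => s'.rreg 5 = 1 / 2)
    (Terminates.of_eval rfl (by simp)) fun s₀ hF₀ h5 => ?_
  have hs₀ := hs.frame hF₀ rfl
  refine (Terminates.forLoop (N := n) (fun k s' => ∀ a < n, ∀ b < n, s'.rarr 1 (a * n + b) =
        s.rarr 1 (a * n + b) + if a < k ∧ a ≠ b then s.rarr 4 (lev a) * (1 / 2) else 0)
    hs₀.size hs₀.one rfl rfl rfl (by decide) (by decide) ?_ ?_).mono le_rfl ?_
  · simp [hF₀.rarr 1 rfl]
  · intro k s₁ hk hk1 hF hI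
    have hs₁ := hs₀.frame hF rfl
    have h5' := (hF.rreg 5 rfl).trans h5
    have h4 : s₁.rarr 4 = s.rarr 4 := by rw [hF.rarr 4 rfl, hF₀.rarr 4 rfl]
    refine Terminates.seq (R := fun s' => s'.nreg 10 = k * n ∧
      s'.rreg 2 = s.rarr 4 (lev k) * (1 / 2))
      (Terminates.of_eval rfl ?_) fun s₂ hF₂ ⟨h10, h2⟩ => ?_
    · simp [hk1, hs₁.row k hk, hs₁.level k hk, h4, h5']
    have hs₂ := hs₁.frame hF₂ rfl
    refine (Terminates.forLoop (N := n) (fun j s' => ∀ a < n, ∀ b < n, s'.rarr 1 (a * n + b) =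
        s.rarr 1 (a * n + b) +
          if (a < k ∨ a = k ∧ b < j) ∧ a ≠ b then s.rarr 4 (lev a) * (1 / 2) else 0)
      hs₂.size hs₂.one rfl rfl rfl (by decide) (by decide) ?_ ?_).mono le_rfl ?_
    · simpa [hF₂.rarr 1 rfl] using hI
    · intro j s₃ hj hj1 hF₃ hJ
      have e10 := hF₃.nreg 10 rfl
      have e2 := hF₃.rreg 2 rfl
      have e4 : s₃.nreg 4 = k := by rw [hF₃.nreg 4 rfl, hF₂.nreg 4 rfl, hk1]
      refine Terminates.of_eval rfl ?_
      intro a ha b hb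
      have hab := hJ a ha b hb
      by_cases h : k = j
      · simp [e4, hj1, h]
        grind
      · simp [e4, hj1, h, e10, h10, address_inj hb hj, e2, h2]
        grind
    · intro s' _ h a ha b hb
      rw [State.setN, h a ha b hb]
      grind
  · intro s' _ h a ha b hb
    rw [h a ha b hb]
    grind

theorem keyProg_spec {n : ℕ} {s : State} (h1 : s.nreg 1 = 1) (h2 : s.nreg 2 = n) :
    Terminates keyProg s (n * (1 + 2) + 2) fun s' => ∀ b < n, s'.rarr 3 b = s.rreg 1 := by
  refine Terminates.forLoop (N := n) (fun k s' => ∀ b < k, s'.rarr 3 b = s.rreg 1) h2 h1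
    rfl rfl rfl (by decide) (by decide) (by simp) fun k s₁ _ hk1 hF hI => ?_
  have e1 := hF.rreg 1 rfl
  refine Terminates.of_eval rfl fun b hb => ?_
  rcases Nat.lt_succ_iff_lt_or_eq.1 hb with hb | rfl
  · simpa [hk1, hb.ne] using hI b hb
  · simp [hk1, e1]

theorem selectProg_spec {n : ℕ} {S : Finset ℕ} {s : State} (h1 : s.nreg 1 = 1) (h2 : s.nreg 2 = n)
    (hvis : ∀ b < n, s.narr 4 b = if b ∈ S then 1 else 0)
    (hkey : ∀ b < n, s.rarr 3 b ≤ s.rreg 1) (hex : ∃ b < n, b ∉ S) :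
    Terminates selectProg s (1 + (n * (6 + 2) + 2)) fun s' =>
      s'.nreg 12 < n ∧ s'.nreg 12 ∉ S ∧ s'.rreg 2 = s.rarr 3 (s'.nreg 12) ∧
      ∀ b < n, b ∉ S → s'.rreg 2 ≤ s.rarr 3 b := by
  refine Terminates.seq (R := fun s' => s'.rreg 2 = s.rreg 1) (Terminates.of_eval rfl (by simp))
    fun s₁ hF₁ hr => ?_
  have e1 : s₁.nreg 1 = 1 := (hF₁.nreg 1 rfl).trans h1
  have e2 : s₁.nreg 2 = n := (hF₁.nreg 2 rfl).trans h2
  refine (Terminates.forLoop (N := n) (fun k s' => (∀ b < k, b ∉ S → s'.rreg 2 ≤ s.rarr 3 b) ∧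
    ((s'.rreg 2 = s.rreg 1 ∧ ∀ b < k, b ∈ S) ∨
      (s'.nreg 12 < n ∧ s'.nreg 12 ∉ S ∧ s'.rreg 2 = s.rarr 3 (s'.nreg 12)))) e2 e1
    rfl rfl rfl (by decide) (by decide) (by simp [hr]) ?_).mono le_rfl ?_
  · rintro k s₂ hk hk1 hF ⟨hI₁, hI₂⟩
    have e1' : s₂.nreg 1 = 1 := (hF.nreg 1 rfl).trans e1
    have e4 : s₂.narr 4 = s.narr 4 := by rw [hF.narr 4 rfl, hF₁.narr 4 rfl]
    have e3 : s₂.rarr 3 = s.rarr 3 := by rw [hF.rarr 3 rfl, hF₁.rarr 3 rfl]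
    refine Terminates.of_eval rfl ?_
    by_cases hkS : k ∈ S
    · simp [hk1, e4, e3, hvis k hk, hkS, e1']
      refine ⟨fun b hb hbS => ?_, hI₂.imp_left fun h => ⟨h.1, fun b hb => ?_⟩⟩ <;>
      · rcases Nat.lt_or_eq_of_le hb with hb | rfl
        · first | exact hI₁ b hb hbS | exact h.2 b hb
        · first | exact absurd hkS hbS | exact hkS
    · by_cases hle : s.rarr 3 k ≤ s₂.rreg 2
      · simp [hk1, e4, e3, hvis k hk, hkS, e1', hle]
        refine ⟨fun b hb hbS => ?_, Or.inr hk⟩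
        rcases Nat.lt_or_eq_of_le hb with hb | rfl
        · exact hle.trans (hI₁ b hb hbS)
        · exact le_rfl
      · simp [hk1, e4, e3, hvis k hk, hkS, e1', hle]
        refine ⟨fun b hb hbS => ?_, Or.inr ?_⟩
        · rcases Nat.lt_or_eq_of_le hb with hb | rfl
          · exact hI₁ b hb hbS
          · exact (not_le.1 hle).le
        · exact hI₂.resolve_left fun h => hle (h.1 ▸ hkey k hk)
  · rintro s' _ ⟨hI₁, hI₂⟩
    obtain ⟨b, hb, hbS⟩ := hex
    obtain ⟨h, h', h''⟩ := hI₂.resolve_left fun h => hbS (h.2 b hb)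
    exact ⟨h, h', h'', hI₁⟩

/-- Here `S` is the set of the points reached so far, `v` the last of them, `v'` the selected point,
and real register `2` holds the distance of `v'` from `S`. -/
theorem extendProg_spec {n : ℕ} {lev : ℕ → ℕ} {D : ℕ → ℕ → ℝ} {S : Finset ℕ} {s : State} {v v' : ℕ}
    (hs : Context n lev D s) (hvis : ∀ b < n, s.narr 4 b = if b ∈ S then 1 else 0)
    (hS : ∀ x ∈ S, x < n) (h12 : s.nreg 12 = v') (hv' : v' < n) (hv'S : v' ∉ S)
    (h13 : s.nreg 13 = v) (hv : S.Nonempty → v ∈ S) :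
    Terminates extendProg s (2 + (n * (11 + 2) + 2 + 5)) fun s' =>
      (∀ b < n, s'.narr 4 b = if b ∈ insert v' S then 1 else 0) ∧ s'.nreg 13 = v' ∧
      (∀ x ∈ S, ∀ y ∈ S, s'.rarr 1 (x * n + y) = s.rarr 1 (x * n + y)) ∧
      (∀ x ∈ S, s'.rarr 1 (v' * n + x) = max (s.rarr 1 (v * n + x)) (s.rreg 2)) ∧
      (∀ x ∈ S, s'.rarr 1 (x * n + v') = max (s.rarr 1 (v * n + x)) (s.rreg 2)) ∧
      s'.rarr 1 (v' * n + v') = 0 := by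
  have hne : ∀ x ∈ S, x ≠ v' := fun x hx hxv => hv'S (hxv ▸ hx)
  refine Terminates.seq (R := fun s' => s'.nreg 10 = v' * n ∧ s'.nreg 11 = s.narr 3 v)
    (Terminates.of_eval rfl (by simp [h12, h13, hs.row v' hv'])) fun s₁ hF₁ ⟨h10, h11⟩ => ?_
  have hs₁ := hs.frame hF₁ rfl
  refine Terminates.seq (R := fun s' =>
      (∀ x ∈ S, ∀ y ∈ S, s'.rarr 1 (x * n + y) = s.rarr 1 (x * n + y)) ∧
      (∀ x ∈ S, s'.rarr 1 (v' * n + x) = max (s.rarr 1 (v * n + x)) (s.rreg 2)) ∧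
      (∀ x ∈ S, s'.rarr 1 (x * n + v') = max (s.rarr 1 (v * n + x)) (s.rreg 2)))
    ((Terminates.forLoop (N := n) (fun k s' =>
      (∀ x ∈ S, ∀ y ∈ S, s'.rarr 1 (x * n + y) = s.rarr 1 (x * n + y)) ∧
      (∀ x ∈ S, x < k → s'.rarr 1 (v' * n + x) = max (s.rarr 1 (v * n + x)) (s.rreg 2)) ∧
      (∀ x ∈ S, x < k → s'.rarr 1 (x * n + v') = max (s.rarr 1 (v * n + x)) (s.rreg 2)))
      hs₁.size hs₁.one rfl rfl rfl (by decide) (by decide) ?_ ?_).mono le_rfl ?_)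
    fun s₂ hF₂ ⟨hA, hB, hC⟩ => ?_
  · simp [hF₁.rarr 1 rfl]
  · rintro k s₂ hk hk1 hF ⟨hI₁, hI₂, hI₃⟩
    have hs₂ := hs₁.frame hF rfl
    have e10 : s₂.nreg 10 = v' * n := (hF.nreg 10 rfl).trans h10
    have e11 : s₂.nreg 11 = s.narr 3 v := (hF.nreg 11 rfl).trans h11
    have e12 : s₂.nreg 12 = v' := by rw [hF.nreg 12 rfl, hF₁.nreg 12 rfl, h12]
    have e2 : s₂.rreg 2 = s.rreg 2 := by rw [hF.rreg 2 rfl, hF₁.rreg 2 rfl]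
    have e4 : s₂.narr 4 = s.narr 4 := by rw [hF.narr 4 rfl, hF₁.narr 4 rfl]
    refine Terminates.of_eval rfl ?_
    by_cases hkS : k ∈ S
    · have hvS : v ∈ S := hv ⟨k, hkS⟩
      have key : ∀ z, ((((Program.seq (block [.nload 9 4 5]) <|
          .ite (.nle 1 9)
            (.seq (block [.nadd 14 11 5, .rload 3 1 14]) <|
              .seq (.ite (.rlt 3 2) (block [.rmove 3 2]) .skip) <|
              block [.nadd 14 10 5, .rstore 1 14 3, .nload 15 3 5, .nadd 15 15 12, .rstore 1 15 3])
            .skip).eval s₂).rarr 1) z =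
          if z = k * n + v' ∨ z = v' * n + k then max (s.rarr 1 (v * n + k)) (s.rreg 2)
          else s₂.rarr 1 z) := by
        intro z
        have hr := hs.row v (hS v hvS)
        have hv1 := hI₁ v hvS k hkS
        by_cases h : s.rarr 1 (v * n + k) < s.rreg 2
        · simp [hk1, e4, hvis k hk, hkS, hs₂.one, hs₂.row k hk, e10, e11, e12, e2, hr, hv1, h]
          grind
        · simp [hk1, e4, hvis k hk, hkS, hs₂.one, hs₂.row k hk, e10, e11, e12, e2, hr, hv1, h]
          grind
      simp only [State.setN, key]
      refine ⟨fun x hx y hy => ?_, fun x hx hxk => ?_, fun x hx hxk => ?_⟩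
      · simp only [address_inj (hS y hy) hv', address_inj (hS y hy) hk]
        rw [if_neg (by simp [hne x hx, hne y hy])]
        exact hI₁ x hx y hy
      · simp only [address_inj (hS x hx) hv', address_inj (hS x hx) hk]
        by_cases hxk' : x = k
        · rw [if_pos (by simp [hxk']), hxk']
        · rw [if_neg (by simp [hxk', hne x hx])]
          exact hI₂ x hx (by omega)
      · simp only [address_inj hv' hv', address_inj hv' hk]
        by_cases hxk' : x = k
        · rw [if_pos (by simp [hxk']), hxk']
        · rw [if_neg (by simp [hxk', hne x hx])]
          exact hI₃ x hx (by omega)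
    · simp only [block, Program.eval, Instr.apply, State.setN, State.setR, Test.Holds,
        Function.update_apply]
      simp [hk1, e4, hvis k hk, hkS, hs₂.one]
      have hlt : ∀ x ∈ S, x ≤ k → x < k := fun x hx hxk =>
        lt_of_le_of_ne hxk fun h => hkS (h ▸ hx)
      exact ⟨hI₁, fun x hx hxk => hI₂ x hx (hlt x hx hxk), fun x hx hxk => hI₃ x hx (hlt x hx hxk)⟩
  · rintro s' _ ⟨hA, hB, hC⟩
    exact ⟨hA, fun x hx => hB x hx (hS x hx), fun x hx => hC x hx (hS x hx)⟩
  · have e10 : s₂.nreg 10 = v' * n := (hF₂.nreg 10 rfl).trans h10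
    have e12 : s₂.nreg 12 = v' := by rw [hF₂.nreg 12 rfl, hF₁.nreg 12 rfl, h12]
    have e1 : s₂.nreg 1 = 1 := by rw [hF₂.nreg 1 rfl, hs₁.one]
    have e4 : s₂.narr 4 = s.narr 4 := by rw [hF₂.narr 4 rfl, hF₁.narr 4 rfl]
    refine Terminates.of_eval rfl ⟨fun b hb => ?_, ?_, fun x hx y hy => ?_, fun x hx => ?_,
      fun x hx => ?_, ?_⟩
    · simp [e12, e1, e4, hvis b hb]
      grind
    · simp [e12]
    · simpa [e12, e10, address_inj (hS y hy) hv', hne y hy] using hA x hx y hy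
    · simpa [e12, e10, address_inj (hS x hx) hv', hne x hx] using hB x hx
    · simpa [e12, e10, hne x hx, Nat.ne_zero_of_lt hv'] using hC x hx
    · simp [e12, e10]

/-- The dissimilarity that agrees with `D` within each level and has the value `B` between
different levels.  With `B` an upper bound of `D`, every level is isolated in the sense of the
field `largest` of `PrimInvariant`. -/
noncomputable def levelwise (lev : ℕ → ℕ) (D : ℕ → ℕ → ℝ) (B : ℝ) (a b : ℕ) : ℝ :=
  if lev a = lev b then D a b else B

theorem relaxProg_spec {n : ℕ} {lev : ℕ → ℕ} {D : ℕ → ℕ → ℝ} {s : State} {v : ℕ}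
    (hs : Context n lev D s) (h12 : s.nreg 12 = v) (hv : v < n) :
    Terminates relaxProg s (2 + (n * (8 + 2) + 2)) fun s' => ∀ b < n,
      s'.rarr 3 b = min (levelwise lev D (s.rreg 1) v b) (s.rarr 3 b) := by
  refine Terminates.seq (R := fun s' => s'.nreg 10 = v * n ∧ s'.nreg 7 = lev v)
    (Terminates.of_eval rfl (by simp [h12, hs.row v hv, hs.level v hv])) fun s₁ hF₁ ⟨h10, h7⟩ => ?_
  have hs₁ := hs.frame hF₁ rfl
  refine (Terminates.forLoop (N := n) (fun k s' => ∀ b < n, s'.rarr 3 b =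
      if b < k then min (levelwise lev D (s.rreg 1) v b) (s.rarr 3 b) else s.rarr 3 b)
      hs₁.size hs₁.one rfl rfl rfl (by decide) (by decide) ?_ ?_).mono le_rfl ?_
  · simp [hF₁.rarr 3 rfl]
  · intro k s₂ hk hk1 hF hI
    have hs₂ := hs₁.frame hF rfl
    have e10 : s₂.nreg 10 = v * n := (hF.nreg 10 rfl).trans h10
    have e7 : s₂.nreg 7 = lev v := (hF.nreg 7 rfl).trans h7
    have e1 : s₂.rreg 1 = s.rreg 1 := by rw [hF.rreg 1 rfl, hF₁.rreg 1 rfl]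
    have hIk := hI k hk
    refine Terminates.of_eval rfl fun b hb => ?_
    have hIb := hI b hb
    by_cases h : lev v = lev k
    · have hd : levelwise lev D (s.rreg 1) v k = D v k := if_pos h
      by_cases h' : D v k ≤ s₂.rarr 3 k
      · simp [hk1, e7, e10, hs₂.level k hk, hs₂.dist v hv k hk, h, h']
        grind
      · simp [hk1, e7, e10, hs₂.level k hk, hs₂.dist v hv k hk, h, h']
        grind
    · have hd : levelwise lev D (s.rreg 1) v k = s.rreg 1 := if_neg h
      by_cases h' : s.rreg 1 ≤ s₂.rarr 3 k
      · simp [hk1, e7, e1, hs₂.level k hk, h, h']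
        grind
      · simp [hk1, e7, e1, hs₂.level k hk, h, h']
        grind
  · intro s' _ h b hb
    rw [h b hb, if_pos hb]

/-- The loop invariant adds to `PrimInvariant` that the key of a point is its smallest dissimilarity
from a point reached so far. -/
theorem primProg_spec {n : ℕ} {lev : ℕ → ℕ} {D : ℕ → ℕ → ℝ} {s : State}
    (hs : Context n lev D s) (h4 : s.narr 4 = fun _ => 0) (hB : 1 ≤ s.rreg 1)
    (hDB : ∀ a < n, ∀ b < n, D a b ≤ s.rreg 1) (hself : ∀ a < n, D a a = 0)
    (hsymm : ∀ a < n, ∀ b < n, D a b = D b a)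
    (hpos : ∀ a < n, ∀ b < n, lev a = lev b → a ≠ b → 0 < D a b) :
    Terminates primProg s (n * (1 + 2) + 2 + (n * (1 + (n * (6 + 2) + 2) +
      (2 + (n * (11 + 2) + 2 + 5) + (2 + (n * (8 + 2) + 2))) + 2) + 2)) fun s' =>
      ∃ v, PrimInvariant n (levelwise lev D (s.rreg 1)) (Finset.range n) v
        fun a b => s'.rarr 1 (a * n + b) := by
  set d := levelwise lev D (s.rreg 1) with hd
  have hdB : ∀ a < n, ∀ b < n, d a b ≤ s.rreg 1 := fun a ha b hb => by
    rw [hd, levelwise]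
    split_ifs
    exacts [hDB a ha b hb, le_rfl]
  refine Terminates.seq (keyProg_spec hs.one hs.size) fun s₁ hF₁ hkey => ?_
  have hs₁ := hs.frame hF₁ rfl
  refine (Terminates.forLoop (N := n) (fun k s' => ∃ S : Finset ℕ, S.card = k ∧ (∀ x ∈ S, x < n) ∧
    (∀ b < n, s'.narr 4 b = if b ∈ S then 1 else 0) ∧
    (PrimInvariant n d S (s'.nreg 13) fun a b => s'.rarr 1 (a * n + b)) ∧
    (∀ b < n, s'.rarr 3 b ≤ s.rreg 1 ∧ (∀ x ∈ S, s'.rarr 3 b ≤ d x b) ∧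
      (s'.rarr 3 b = s.rreg 1 ∧ S = ∅ ∨ ∃ p ∈ S, s'.rarr 3 b = d p b)))
    hs₁.size hs₁.one rfl rfl rfl (by decide) (by decide) ?_ ?_).mono le_rfl ?_
  · refine ⟨∅, rfl, by simp, ?_, PrimInvariant.empty _ _ _ _, ?_⟩
    · simp [hF₁.narr 4 rfl, h4]
    · intro b hb
      simp [hkey b hb]
  · rintro k s₂ hk hk1 hF ⟨S, hcard, hS, hvis, hinv, hkeys⟩
    have hs₂ := hs₁.frame hF rfl
    have e1 : s₂.rreg 1 = s.rreg 1 := by rw [hF.rreg 1 rfl, hF₁.rreg 1 rfl]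
    have hex : ∃ b < n, b ∉ S := by
      by_contra! h
      have := Finset.card_le_card (s := Finset.range n) (t := S) fun b hb =>
        h b (Finset.mem_range.1 hb)
      rw [Finset.card_range] at this
      omega
    refine Terminates.seq (selectProg_spec hs₂.one hs₂.size hvis
      (fun b hb => by rw [e1]; exact (hkeys b hb).1) hex) fun s₃ hF₃ ⟨hv, hvS, hw, hmin⟩ => ?_
    have hs₃ := hs₂.frame hF₃ rfl
    refine Terminates.seq (extendProg_spec (v := s₂.nreg 13) hs₃
      (by rw [hF₃.narr 4 rfl]; exact hvis) hS rfl hv hvS (hF₃.nreg 13 rfl) hinv.last_mem)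
      fun s₄ hF₄ ⟨hvis', h13, hA, hB', hC, hE⟩ => ?_
    have hs₄ := hs₃.frame hF₄ rfl
    have e1' : s₄.rreg 1 = s.rreg 1 := by rw [hF₄.rreg 1 rfl, hF₃.rreg 1 rfl, e1]
    refine (relaxProg_spec hs₄ (hF₄.nreg 12 rfl) hv).mono le_rfl fun s₅ hF₅ hrel => ?_
    rw [e1', ← hd, hF₄.rarr 3 rfl, hF₃.rarr 3 rfl] at hrel
    rw [hF₃.rarr 1 rfl] at hA hB' hC
    refine ⟨insert (s₃.nreg 12) S, by rw [Finset.card_insert_of_notMem hvS, hcard],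
      by simpa [Finset.forall_mem_insert] using ⟨hv, hS⟩, ?_, ?_, ?_⟩
    · change ∀ b < n, s₅.narr 4 b = _
      rw [hF₅.narr 4 rfl]
      exact hvis'
    · have e13 : (s₅.setN 4 (k + 1)).nreg 13 = s₃.nreg 12 := by
        change Function.update s₅.nreg 4 (k + 1) 13 = _
        rw [Function.update_of_ne (by decide), hF₅.nreg 13 rfl, h13]
      rw [e13]
      change PrimInvariant n d _ _ fun a b => s₅.rarr 1 (a * n + b)
      rw [hF₅.rarr 1 rfl]
      refine hinv.insert ?_ ?_ ?_ hS hv hvS (w := s₃.rreg 2) ?_ ?_ hA hB' hC hE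
      · intro x hx
        simp [hd, levelwise, hself x hx]
      · intro x hx y hy
        simp [hd, levelwise, hsymm x hx y hy, eq_comm]
      · intro x hx y hy hxy
        rw [hd, levelwise]
        split_ifs with h
        · exact hpos x hx y hy h hxy
        · linarith
      · intro hne
        obtain h | ⟨p, hp, h⟩ := (hkeys _ hv).2.2
        · exact absurd h.2 hne.ne_empty
        · exact ⟨p, hp, hw.trans h⟩
      · exact fun x hx b hb hbS => (hmin b hb hbS).trans ((hkeys b hb).2.1 x hx)
    · intro b hb
      change s₅.rarr 3 b ≤ _ ∧ (∀ x ∈ _, s₅.rarr 3 b ≤ _) ∧ (s₅.rarr 3 b = _ ∧ _ ∨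
        ∃ p ∈ _, s₅.rarr 3 b = _)
      rw [hrel b hb]
      obtain ⟨hk₁, hk₂, hk₃⟩ := hkeys b hb
      refine ⟨min_le_of_right_le hk₁, ?_, Or.inr ?_⟩
      · simp only [Finset.forall_mem_insert]
        exact ⟨min_le_left _ _, fun x hx => min_le_of_right_le (hk₂ x hx)⟩
      · rcases le_total (d (s₃.nreg 12) b) (s₂.rarr 3 b) with h | h
        · exact ⟨_, Finset.mem_insert_self _ _, min_eq_left h⟩
        · rcases hk₃ with h' | ⟨p, hp, h'⟩
          · refine ⟨_, Finset.mem_insert_self _ _, min_eq_left ?_⟩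
            rw [h'.1]
            exact hdB _ hv b hb
          · exact ⟨p, Finset.mem_insert_of_mem hp, (min_eq_right h).trans h'⟩
  · rintro s' _ ⟨S, hcard, hS, -, hinv, -⟩
    have hSn : S = Finset.range n := Finset.eq_of_subset_of_card_le
      (fun x hx => Finset.mem_range.2 (hS x hx)) (by rw [Finset.card_range, hcard])
    exact ⟨_, hSn ▸ hinv⟩

/-! ### Correctness of the whole program -/

/-- What the algorithm computes, in terms of the numbers of the points: `D` is the matrix of the
distances, `u` the result of Prim's algorithm, `E l` the largest defect `D - u` on level `l`, and
`H (l + 1)` the Hausdorff distance of the levels `l` and `l + 1`.  The values of `H` at `0` and at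
the number of levels are meaningless but harmless. -/
structure ClusterOutput (n : ℕ) (lev : ℕ → ℕ) (D : ℕ → ℕ → ℝ) (s : State) (B : ℝ) (v : ℕ)
    (u : ℕ → ℕ → ℝ) (E H : ℕ → ℝ) : Prop where
  bound : ∀ a < n, ∀ b < n, D a b ≤ B
  prim : PrimInvariant n (levelwise lev D B) (Finset.range n) v u
  defect_le : ∀ a < n, ∀ b < n, lev a = lev b → D a b - u a b ≤ E (lev a)
  defect_eq : ∀ l, E l = 0 ∨ ∃ a < n, ∃ b < n, lev a = l ∧ lev b = l ∧ E l = D a b - u a b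
  dist : ∀ a < n, ∀ b < n, s.rarr 1 (a * n + b) =
    u a b + if a = b then 0 else E (lev a) * (1 / 2)
  haus_nonneg : ∀ l, 0 ≤ H l
  haus_succ : ∀ a < n, (∃ b < n, lev b = lev a + 1) → ∃ b < n, lev b = lev a + 1 ∧
    D a b ≤ H (lev a + 1)
  haus_pred : ∀ b < n, (∃ a < n, lev a + 1 = lev b) → ∃ a < n, lev a + 1 = lev b ∧
    D b a ≤ H (lev b)
  haus_le : ∀ l r, 0 ≤ r → (∀ a < n, lev a + 1 = l → ∃ b < n, lev b = l ∧ D a b ≤ r) →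
    (∀ b < n, lev b = l → ∃ a < n, lev a + 1 = l ∧ D b a ≤ r) → H l ≤ r
  rel : ∀ a < n, ∀ b < n, s.narr 1 (a * n + b) = 1 ↔ lev b = lev a + 1 ∧ D a b ≤ H (lev a + 1)

theorem clusterProg_spec {T n : ℕ} {card lev : ℕ → ℕ} {D : ℕ → ℕ → ℝ} {s : State} (hT : 0 < T)
    (hsT : s.narr 0 0 = T) (hc : ∀ i < T, s.narr 0 (i + 1) = card i) (hpos : ∀ i < T, 0 < card i)
    (hn : n = ∑ i ∈ Finset.range T, card i)
    (hlev : ∀ a < n, ∑ i ∈ Finset.range (lev a), card i ≤ a ∧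
      a < ∑ i ∈ Finset.range (lev a + 1), card i)
    (hD : ∀ a < n, ∀ b < n, s.rarr 0 (a * n + b) = D a b) (hself : ∀ a < n, D a a = 0)
    (hsymm : ∀ a < n, ∀ b < n, D a b = D b a)
    (hDpos : ∀ a < n, ∀ b < n, lev a = lev b → a ≠ b → 0 < D a b)
    (hn1 : s.narr 1 = fun _ => 0) (hn4 : s.narr 4 = fun _ => 0)
    (hr4 : s.rarr 4 = fun _ => 0) (hr5 : s.rarr 5 = fun _ => 0) :
    Terminates clusterProg s (400 * n ^ 2) fun s' => ∃ B v u E H,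
      ClusterOutput n lev D s' B v u E H := by
  have hTn : T ≤ n := by
    have := Finset.sum_le_sum (s := Finset.range T) fun i hi =>
      Nat.succ_le_of_lt (hpos i (Finset.mem_range.1 hi))
    rw [hn]
    simpa using this
  refine Terminates.mono (Terminates.seq (sizeProg_spec hsT hc) fun s₁ hF₁ ⟨h1, h2⟩ =>
    Terminates.seq (tableProg_spec hT (fun i hi => by rw [hF₁.narr 0 rfl, hc i hi]) hpos h1
      (h2.trans hn.symm) hn hlev) fun s₂ hF₂ ⟨h6, htab⟩ => ?_) (T := 4 + (T * (3 + 2) + 2) +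
      (3 + (n * (10 + 2) + 2) + (1 + (n * n * (3 + 2) + 2) +
      (n * (1 + 2) + 2 + (n * (1 + (n * (6 + 2) + 2) + (2 + (n * (11 + 2) + 2 + 5) +
        (2 + (n * (8 + 2) + 2))) + 2) + 2) +
      (n * (2 + (n * (10 + 2) + 2) + 2) + 2 + (1 + (n * (4 + (n * (6 + 2) + 2) + 2) + 2) +
      (n * (3 + (n * (7 + 2) + 2 + 3) + 2) + 2 + (n * (3 + (n * (7 + 2) + 2 + 3) + 2) + 2 +
      (n * (3 + (n * (7 + 2) + 2) + 2) + 2))))))))) ?_ fun _ _ h => h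
  · have hs₂ : Context n lev D s₂ := by
      refine ⟨by rw [hF₂.nreg 1 rfl, h1], by rw [hF₂.nreg 2 rfl, h2, hn],
        fun a ha => (htab a ha).1, fun a ha => (htab a ha).2.1, fun a ha => (htab a ha).2.2, ?_⟩
      rw [hF₂.rarr 0 rfl, hF₁.rarr 0 rfl]
      exact hD
    refine Terminates.seq (boundProg_spec hs₂.one h6) fun s₃ hF₃ ⟨hB, hDB⟩ => ?_
    have hs₃ := hs₂.frame hF₃ rfl
    have hDB' : ∀ a < n, ∀ b < n, D a b ≤ s₃.rreg 1 := fun a ha b hb => by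
      rw [← hs₂.dist a ha b hb]
      refine hDB _ ?_
      calc a * n + b < a * n + n := by omega
        _ = (a + 1) * n := by ring
        _ ≤ n * n := Nat.mul_le_mul_right n ha
    refine Terminates.seq (primProg_spec hs₃ (by rw [hF₃.narr 4 rfl, hF₂.narr 4 rfl,
      hF₁.narr 4 rfl, hn4]) hB hDB' hself hsymm hDpos) fun s₄ hF₄ ⟨v, hprim⟩ => ?_
    have hs₄ := hs₃.frame hF₄ rfl
    refine Terminates.seq (defectProg_spec hs₄ (by rw [hF₄.rarr 4 rfl, hF₃.rarr 4 rfl,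
      hF₂.rarr 4 rfl, hF₁.rarr 4 rfl, hr4])) fun s₅ hF₅ ⟨hE, hE'⟩ => ?_
    have hs₅ := hs₄.frame hF₅ rfl
    refine Terminates.seq (shiftProg_spec hs₅) fun s₆ hF₆ hshift => ?_
    have hs₆ := hs₅.frame hF₆ rfl
    have e1 : s₆.rreg 1 = s₃.rreg 1 := by
      rw [hF₆.rreg 1 rfl, hF₅.rreg 1 rfl, hF₄.rreg 1 rfl]
    have e5 : s₆.rarr 5 = fun _ => 0 := by
      rw [hF₆.rarr 5 rfl, hF₅.rarr 5 rfl, hF₄.rarr 5 rfl, hF₃.rarr 5 rfl, hF₂.rarr 5 rfl,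
        hF₁.rarr 5 rfl, hr5]
    refine Terminates.seq (hausdorffProg_spec (Or.inr rfl) (Or.inl rfl) (f := fun a => lev a + 1)
      (g := lev) hs₆ hs₆.level_succ hs₆.level (e1 ▸ hDB')) fun s₇ hF₇ ⟨hH₁, hH₂, hH₃⟩ => ?_
    have hs₇ := hs₆.frame hF₇ rfl
    have e1' : s₇.rreg 1 = s₃.rreg 1 := by rw [hF₇.rreg 1 rfl, e1]
    refine Terminates.seq (hausdorffProg_spec (Or.inl rfl) (Or.inr rfl) (f := lev)
      (g := fun a => lev a + 1) hs₇ hs₇.level hs₇.level_succ (e1' ▸ hDB'))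
      fun s₈ hF₈ ⟨hK₁, hK₂, hK₃⟩ => ?_
    have hs₈ := hs₇.frame hF₈ rfl
    refine (relProg_spec hs₈ (by rw [hF₈.narr 1 rfl, hF₇.narr 1 rfl, hF₆.narr 1 rfl,
      hF₅.narr 1 rfl, hF₄.narr 1 rfl, hF₃.narr 1 rfl, hF₂.narr 1 rfl, hF₁.narr 1 rfl,
      hn1])).mono le_rfl fun s₉ hF₉ hrel => ?_
    simp only [e5] at hH₁ hH₃
    refine ⟨s₃.rreg 1, v, _, s₅.rarr 4, s₈.rarr 5, hDB', hprim, hE, hE', ?_,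
      fun l => (hH₁ l).trans (hK₁ l), fun a ha hex => ?_, hK₂, fun l r hr hl hl' => ?_, hrel⟩
    · rw [hF₉.rarr 1 rfl, hF₈.rarr 1 rfl, hF₇.rarr 1 rfl, ← hF₅.rarr 1 rfl]
      exact hshift
    · obtain ⟨b, hb, hba, hle⟩ := hH₂ a ha hex
      exact ⟨b, hb, hba, hle.trans (hK₁ _)⟩
    · exact hK₃ l r (hH₃ l r hr hl) hl'
  · have : 1 ≤ n := hT.trans_le hTn
    nlinarith [Nat.mul_le_mul this this, Nat.mul_le_mul_left n this]

namespace TemporalSampling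

variable {X : Type*} {t : ℕ}

/-! ### Numbering the points -/

/-- The number of points of the level with a given number, and `0` if there is no such level. -/
def levelCard (P : TemporalSampling X t) (i : ℕ) : ℕ :=
  if h : i < t + 1 then (P.level ⟨i, h⟩).card else 0

/-- The level of the point with a given number, and `0` if there is no such point. -/
def levelOf (P : TemporalSampling X t) (a : ℕ) : ℕ :=
  if h : a < P.size then
    ((finSigmaFinEquiv (n := fun i => (P.level i).card)).symm ⟨a, h⟩).1 else 0

theorem exists_index_eq (P : TemporalSampling X t) (e : P.Enumeration) {a : ℕ} (ha : a < P.size) :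
    ∃ i x, (P.index e i x : ℕ) = a := by
  let σ := (finSigmaFinEquiv (n := fun i => (P.level i).card)).symm ⟨a, ha⟩
  refine ⟨σ.1, e σ.1 σ.2, ?_⟩
  simp [index, σ]

theorem levelOf_index (P : TemporalSampling X t) (e : P.Enumeration) (i : Fin (t + 1))
    (x : P.level i) : P.levelOf (P.index e i x) = i := by
  rw [levelOf, dif_pos (P.index e i x).2]
  simp only [Fin.eta, index, Equiv.symm_apply_apply]

theorem index_injective (P : TemporalSampling X t) (e : P.Enumeration) (i : Fin (t + 1)) :
    Function.Injective fun x : P.level i => (P.index e i x : ℕ) := by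
  intro x y h
  simpa [index, Fin.val_inj] using h

theorem point_index (P : TemporalSampling X t) (e : P.Enumeration) (i : Fin (t + 1))
    (x : P.level i) : P.point e (P.index e i x) = x := by
  have h : ∀ σ : (i : Fin (t + 1)) × Fin (P.level i).card, σ = ⟨i, (e i).symm x⟩ →
      (e σ.1 σ.2 : X) = x := by
    rintro _ rfl
    rw [Equiv.apply_symm_apply]
  exact h _ (Equiv.symm_apply_apply _ _)

theorem levelCard_val (P : TemporalSampling X t) (i : Fin (t + 1)) :
    P.levelCard i = (P.level i).card := dif_pos i.2

theorem sum_levelCard (P : TemporalSampling X t) :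
    P.size = ∑ i ∈ Finset.range (t + 1), P.levelCard i := by
  rw [Finset.sum_range]
  simp only [size, levelCard_val]

theorem sum_levelCard_le_lt (P : TemporalSampling X t) (e : P.Enumeration) {a : ℕ}
    (ha : a < P.size) : ∑ i ∈ Finset.range (P.levelOf a), P.levelCard i ≤ a ∧
      a < ∑ i ∈ Finset.range (P.levelOf a + 1), P.levelCard i := by
  obtain ⟨i, x, rfl⟩ := P.exists_index_eq e ha
  have h : (P.index e i x : ℕ) = ∑ j ∈ Finset.range i, P.levelCard j + (e i).symm x := by
    rw [index, finSigmaFinEquiv_apply, Finset.sum_range]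
    congr 1
    refine Finset.sum_congr rfl fun j _ => ?_
    rw [levelCard, dif_pos (j.2.trans i.2)]
    rfl
  rw [P.levelOf_index, Finset.sum_range_succ, h, levelCard_val]
  have := ((e i).symm x).2
  omega

theorem input_dist [MetricSpace X] (P : TemporalSampling X t) (e : P.Enumeration)
    (i j : Fin (t + 1)) (x : P.level i) (y : P.level j) :
    (P.input e).rarr 0 (P.index e i x * P.size + P.index e j y) = dist (x : X) (y : X) := by
  have hx := (P.index e i x).2
  have hy := (P.index e j y).2
  have h : (P.index e i x * P.size + P.index e j y : ℕ) < P.size * P.size :=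
    calc (P.index e i x * P.size + P.index e j y : ℕ) < P.index e i x * P.size + P.size := by omega
      _ = (P.index e i x + 1) * P.size := by ring
      _ ≤ P.size * P.size := Nat.mul_le_mul_right _ hx
  have h1 : Fin.divNat ⟨_, h⟩ = P.index e i x := by
    ext
    simp [Fin.divNat, Nat.add_div_of_dvd_right (Nat.dvd_mul_left P.size _), Nat.div_eq_of_lt hy,
      Nat.mul_div_cancel _ (Nat.zero_lt_of_lt hy)]
  have h2 : Fin.modNat ⟨_, h⟩ = P.index e j y := by
    ext
    simp [Fin.modNat, Nat.mod_eq_of_lt hy]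
  simp only [input, if_true, dif_pos h]
  rw [h1, h2, P.point_index, P.point_index]

/-! ### The Hausdorff distance of finite levels -/

/-- The Hausdorff distance is the least `r ≥ 0` such that each point of either level is within
distance `r` of some point of the other one; in particular it is attained. -/
theorem hausdorff_le_iff [MetricSpace X] (P : TemporalSampling X t) (i : Fin t) {r : ℝ}
    (hr : 0 ≤ r) : P.hausdorff i ≤ r ↔
      (∀ x : P.level i.castSucc, ∃ y : P.level i.succ, dist (x : X) y ≤ r) ∧
      ∀ y : P.level i.succ, ∃ x : P.level i.castSucc, dist (y : X) x ≤ r := by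
  have fin₁ : (P.level i.castSucc : Set X).Finite := Finset.finite_toSet _
  have fin₂ : (P.level i.succ : Set X).Finite := Finset.finite_toSet _
  have ne₁ : (P.level i.castSucc : Set X).Nonempty := P.nonempty _
  have ne₂ : (P.level i.succ : Set X).Nonempty := P.nonempty _
  have hfin := Metric.hausdorffEDist_ne_top_of_nonempty_of_bounded ne₁ ne₂ fin₁.isBounded
    fin₂.isBounded
  constructor
  · intro h
    refine ⟨fun x => ?_, fun y => ?_⟩
    · obtain ⟨y, hy, hxy⟩ := fin₂.isCompact.exists_infDist_eq_dist ne₂ (x : X)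
      refine ⟨⟨y, hy⟩, hxy.symm.le.trans (le_trans ?_ h)⟩
      exact Metric.infDist_le_hausdorffDist_of_mem x.2 hfin
    · obtain ⟨x, hx, hxy⟩ := fin₁.isCompact.exists_infDist_eq_dist ne₁ (y : X)
      refine ⟨⟨x, hx⟩, hxy.symm.le.trans (le_trans ?_ h)⟩
      rw [hausdorff, Metric.hausdorffDist_comm]
      rw [Metric.hausdorffEDist_comm] at hfin
      exact Metric.infDist_le_hausdorffDist_of_mem y.2 hfin
  · rintro ⟨h, h'⟩
    refine Metric.hausdorffDist_le_of_mem_dist hr (fun x hx => ?_) fun y hy => ?_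
    · obtain ⟨y, hy⟩ := h ⟨x, hx⟩
      exact ⟨y, y.2, hy⟩
    · obtain ⟨x, hx⟩ := h' ⟨y, hy⟩
      exact ⟨x, x.2, hx⟩

theorem hausdorff_nonneg [MetricSpace X] (P : TemporalSampling X t) (i : Fin t) :
    0 ≤ P.hausdorff i := Metric.hausdorffDist_nonneg

/-- The pairs within the Hausdorff distance form a correspondence. -/
theorem isCorrespondence_hausdorff [MetricSpace X] (P : TemporalSampling X t) (i : Fin t) :
    IsCorrespondence {q : P.level i.castSucc × P.level i.succ |
      dist (q.1 : X) (q.2 : X) ≤ P.hausdorff i} := by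
  obtain ⟨h, h'⟩ := (P.hausdorff_le_iff i (P.hausdorff_nonneg i)).1 le_rfl
  constructor
  · refine Set.eq_univ_of_forall fun x => ?_
    obtain ⟨y, hy⟩ := h x
    exact ⟨(x, y), hy, rfl⟩
  · refine Set.eq_univ_of_forall fun y => ?_
    obtain ⟨x, hx⟩ := h' y
    exact ⟨(x, y), by rwa [dist_comm] at hx, rfl⟩

/-- No correspondence has a smaller locality than the Hausdorff distance. -/
theorem IsLocalClustering.hausdorff_le [MetricSpace X] {P : TemporalSampling X t} {χ δ : ℝ}
    {μ : P.LevelDist} {C : P.LevelRel} (h : P.IsLocalClustering χ δ μ C) (i : Fin t) :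
    P.hausdorff i ≤ δ := by
  refine (P.hausdorff_le_iff i h.delta_nonneg).2 ⟨fun x => ?_, fun y => ?_⟩
  · obtain ⟨⟨x', y⟩, hq, rfl⟩ : x ∈ Prod.fst '' C i := (h.corr i).1 ▸ Set.mem_univ x
    exact ⟨y, h.loc i _ hq⟩
  · obtain ⟨⟨x, y'⟩, hq, rfl⟩ : y ∈ Prod.snd '' C i := (h.corr i).2 ▸ Set.mem_univ y
    exact ⟨x, by rw [dist_comm]; exact h.loc i _ hq⟩

theorem isLeast_locality [MetricSpace X] (P : TemporalSampling X t) :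
    IsLeast {δ : ℝ | ∃ χ : ℝ, P.Admits χ δ} (⨆ i : Fin t, P.hausdorff i) := by
  have hfin := Set.finite_range fun i => LInf (P.ambient i) fun _ _ => 0
  refine ⟨⟨⨆ i, LInf (P.ambient i) fun _ _ => 0, fun i _ _ => 0, fun i => {q |
      dist (q.1 : X) (q.2 : X) ≤ P.hausdorff i}, ?_, Real.iSup_nonneg P.hausdorff_nonneg,
      fun i => ⟨by simp, by simp, by simp, by simp⟩, fun i => le_ciSup hfin.bddAbove i,
      P.isCorrespondence_hausdorff, fun i q hq => hq.trans ?_⟩, ?_⟩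
  · exact Real.iSup_nonneg fun i => Real.iSup_nonneg fun q => abs_nonneg _
  · exact le_ciSup (Set.finite_range P.hausdorff).bddAbove i
  · rintro δ ⟨χ, μ, C, h⟩
    exact Real.iSup_le h.hausdorff_le h.delta_nonneg

/-! ### Reading off the output -/

/-- `clusterProg_spec` for the input that encodes a temporal-sampling. -/
theorem clusterProg_terminates [MetricSpace X] (P : TemporalSampling X t) (e : P.Enumeration) :
    Terminates clusterProg (P.input e) (400 * P.size ^ 2) fun s => ∃ B v u E H,
      ClusterOutput P.size P.levelOf (fun a b => (P.input e).rarr 0 (a * P.size + b)) s B v u E H := by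
  refine clusterProg_spec (T := t + 1) (card := P.levelCard) (Nat.succ_pos t) (by simp [input])
    (fun i hi => ?_) (fun i hi => ?_) P.sum_levelCard (fun a ha => P.sum_levelCard_le_lt e ha)
    (fun _ _ _ _ => rfl) (fun a ha => ?_) (fun a ha b hb => ?_) (fun a ha b hb hab hne => ?_)
    (by simp [input]) (by simp [input]) (by simp [input]) (by simp [input])
  · simp [input, levelCard]
  · rw [levelCard, dif_pos hi]
    exact (P.nonempty _).card_pos
  · obtain ⟨i, x, rfl⟩ := P.exists_index_eq e ha
    rw [P.input_dist, dist_self]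
  · obtain ⟨i, x, rfl⟩ := P.exists_index_eq e ha
    obtain ⟨j, y, rfl⟩ := P.exists_index_eq e hb
    rw [P.input_dist, P.input_dist, dist_comm]
  · obtain ⟨i, x, rfl⟩ := P.exists_index_eq e ha
    obtain ⟨j, y, rfl⟩ := P.exists_index_eq e hb
    rw [P.levelOf_index, P.levelOf_index, Fin.val_inj] at hab
    subst hab
    rw [P.input_dist, dist_pos]
    intro h
    exact hne (by rw [Subtype.ext h])

section Output

variable [MetricSpace X] {P : TemporalSampling X t} {e : P.Enumeration} {s : State} {B : ℝ} {v : ℕ}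
  {u : ℕ → ℕ → ℝ} {E H : ℕ → ℝ}

theorem outputDist_self (h : ClusterOutput P.size P.levelOf
    (fun a b => (P.input e).rarr 0 (a * P.size + b)) s B v u E H) (i : Fin (t + 1))
    (x : P.level i) : P.outputDist e s i x x = 0 := by
  have hx := (P.index e i x).2
  rw [outputDist, h.dist _ hx _ hx, if_pos rfl, h.prim.self _ (Finset.mem_range.2 hx), add_zero]

theorem outputDist_of_ne (h : ClusterOutput P.size P.levelOf
    (fun a b => (P.input e).rarr 0 (a * P.size + b)) s B v u E H) (i : Fin (t + 1))
    (x y : P.level i) (hxy : x ≠ y) : P.outputDist e s i x y =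
      u (P.index e i x) (P.index e i y) + E i * (1 / 2) := by
  rw [outputDist, h.dist _ (P.index e i x).2 _ (P.index e i y).2,
    if_neg fun h' => hxy (P.index_injective e i h'), P.levelOf_index]

theorem levelwise_index (i : Fin (t + 1)) (x y : P.level i) :
    levelwise P.levelOf (fun a b => (P.input e).rarr 0 (a * P.size + b)) B (P.index e i x)
      (P.index e i y) = dist (x : X) (y : X) := by
  rw [levelwise, P.levelOf_index, P.levelOf_index, if_pos rfl, P.input_dist]

theorem defect_le_index (h : ClusterOutput P.size P.levelOf
    (fun a b => (P.input e).rarr 0 (a * P.size + b)) s B v u E H) (i : Fin (t + 1))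
    (x y : P.level i) : dist (x : X) (y : X) - u (P.index e i x) (P.index e i y) ≤ E i := by
  have := h.defect_le _ (P.index e i x).2 _ (P.index e i y).2 (by simp only [P.levelOf_index])
  rwa [P.input_dist, P.levelOf_index] at this

theorem isUltrametric_outputDist (h : ClusterOutput P.size P.levelOf
    (fun a b => (P.input e).rarr 0 (a * P.size + b)) s B v u E H) (i : Fin (t + 1)) :
    IsUltrametric (P.outputDist e s i) := by
  have hmem : ∀ x : P.level i, (P.index e i x : ℕ) ∈ Finset.range P.size :=
    fun x => Finset.mem_range.2 (P.index e i x).2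
  have hE : 0 ≤ E i := by
    obtain ⟨x, hx⟩ := P.nonempty i
    have := defect_le_index h i ⟨x, hx⟩ ⟨x, hx⟩
    rwa [h.prim.self _ (hmem _), dist_self, sub_zero] at this
  exact isUltrametric_shift (u := fun x y => u (P.index e i x) (P.index e i y)) (ε := E i * (1 / 2))
    (by linarith) (fun x => h.prim.self _ (hmem x)) (fun x y => h.prim.symm _ (hmem x) _ (hmem y))
    (fun x y z => h.prim.ultra _ (hmem x) _ (hmem y) _ (hmem z))
    (fun x y hxy => h.prim.pos _ (hmem x) _ (hmem y) fun h' => hxy (P.index_injective e i h'))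
    (outputDist_self h i) (outputDist_of_ne h i)

theorem LInf_outputDist_le (h : ClusterOutput P.size P.levelOf
    (fun a b => (P.input e).rarr 0 (a * P.size + b)) s B v u E H) (i : Fin (t + 1))
    {ν : P.level i → P.level i → ℝ} (hν : IsPseudoUltrametric ν) :
    LInf (P.ambient i) (P.outputDist e s i) ≤ LInf (P.ambient i) ν := by
  have hmem : ∀ x : P.level i, (P.index e i x : ℕ) ∈ Finset.range P.size :=
    fun x => Finset.mem_range.2 (P.index e i x).2
  have : Nonempty (P.level i) := (P.nonempty i).to_subtype
  refine LInf_shift_le (u := fun x y => u (P.index e i x) (P.index e i y)) (E := E i)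
    (fun x => dist_self _) (fun x y => ?_) (defect_le_index h i) ?_ (outputDist_self h i)
    (outputDist_of_ne h i) fun χ hχ => ?_
  · change _ ≤ dist (x : X) (y : X)
    rw [← levelwise_index (e := e) (B := B)]
    exact h.prim.le _ (hmem x) _ (hmem y)
  · refine (h.defect_eq i).imp_right ?_
    rintro ⟨a, ha, b, hb, hai, hbi, heq⟩
    obtain ⟨j, x, rfl⟩ := P.exists_index_eq e ha
    obtain ⟨k, y, rfl⟩ := P.exists_index_eq e hb
    rw [P.levelOf_index, Fin.val_inj] at hai hbi
    subst hai
    subst hbi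
    exact ⟨x, y, by rw [heq, P.input_dist]; rfl⟩
  · -- `ν` is pulled back to the numbers of the points along a left inverse of the numbering
    let g := Function.invFun fun x : P.level i => (P.index e i x : ℕ)
    have hg : ∀ x, g (P.index e i x) = x := Function.leftInverse_invFun (P.index_injective e i)
    have key := h.prim.largest (Set.range fun x : P.level i => (P.index e i x : ℕ))
      (fun a b => ν (g a) (g b)) χ
      ⟨fun _ _ => hν.nonneg _ _, fun _ => hν.self _, fun _ _ => hν.symm _ _,
        fun _ _ _ => hν.ultra _ _ _⟩ ?_ ?_
    · intro x y
      have := key _ (hmem x) ⟨x, rfl⟩ _ (hmem y) ⟨y, rfl⟩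
      rwa [hg, hg] at this
    · rintro _ ⟨x, rfl⟩ _ ⟨y, rfl⟩
      simp only [hg, levelwise_index]
      exact hχ x y
    · rintro _ ⟨x, rfl⟩ _ ⟨y, rfl⟩ p hp hpi
      obtain ⟨j, z, rfl⟩ := P.exists_index_eq e hp
      have hji : j ≠ i := by
        rintro rfl
        exact hpi ⟨z, rfl⟩
      simp only [levelwise_index]
      rw [levelwise, P.levelOf_index, P.levelOf_index, if_neg (Fin.val_injective.ne hji),
        ← P.input_dist e]
      exact h.bound _ (P.index e i x).2 _ (P.index e i y).2

theorem outputRel_eq (h : ClusterOutput P.size P.levelOf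
    (fun a b => (P.input e).rarr 0 (a * P.size + b)) s B v u E H) (i : Fin t) :
    P.outputRel e s i = {q | dist (q.1 : X) (q.2 : X) ≤ P.hausdorff i} := by
  have hH : H (i + 1) = P.hausdorff i := by
    apply le_antisymm
    · obtain ⟨h₁, h₂⟩ := (P.hausdorff_le_iff i (P.hausdorff_nonneg i)).1 le_rfl
      refine h.haus_le _ _ (P.hausdorff_nonneg i) (fun a ha hai => ?_) fun b hb hbi => ?_
      · obtain ⟨j, x, rfl⟩ := P.exists_index_eq e ha
        rw [P.levelOf_index] at hai
        obtain rfl : j = i.castSucc := Fin.ext (by simpa using hai)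
        obtain ⟨y, hy⟩ := h₁ x
        exact ⟨_, (P.index e _ y).2, by rw [P.levelOf_index, Fin.val_succ], by rwa [P.input_dist]⟩
      · obtain ⟨j, y, rfl⟩ := P.exists_index_eq e hb
        rw [P.levelOf_index] at hbi
        obtain rfl : j = i.succ := Fin.ext (by simpa using hbi)
        obtain ⟨x, hx⟩ := h₂ y
        exact ⟨_, (P.index e _ x).2, by rw [P.levelOf_index, Fin.val_castSucc],
          by rwa [P.input_dist]⟩
    · refine (P.hausdorff_le_iff i (h.haus_nonneg _)).2 ⟨fun x => ?_, fun y => ?_⟩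
      · obtain ⟨y₀, hy₀⟩ := P.nonempty i.succ
        obtain ⟨b, hb, hbi, hle⟩ := h.haus_succ _ (P.index e _ x).2
          ⟨_, (P.index e _ ⟨y₀, hy₀⟩).2, by simp [P.levelOf_index]⟩
        obtain ⟨j, y, rfl⟩ := P.exists_index_eq e hb
        rw [P.levelOf_index, P.levelOf_index, Fin.val_castSucc] at hbi
        obtain rfl : j = i.succ := Fin.ext (by simpa using hbi)
        rw [P.input_dist, P.levelOf_index, Fin.val_castSucc] at hle
        exact ⟨y, hle⟩
      · obtain ⟨x₀, hx₀⟩ := P.nonempty i.castSucc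
        obtain ⟨a, ha, hai, hle⟩ := h.haus_pred _ (P.index e _ y).2
          ⟨_, (P.index e _ ⟨x₀, hx₀⟩).2, by simp [P.levelOf_index]⟩
        obtain ⟨j, x, rfl⟩ := P.exists_index_eq e ha
        rw [P.levelOf_index, P.levelOf_index, Fin.val_succ] at hai
        obtain rfl : j = i.castSucc := Fin.ext (by simpa using hai)
        rw [P.input_dist, P.levelOf_index, Fin.val_succ] at hle
        exact ⟨x, hle⟩
  ext ⟨x, y⟩
  have := h.rel _ (P.index e _ x).2 _ (P.index e _ y).2
  rw [P.levelOf_index, P.levelOf_index, P.input_dist, Fin.val_castSucc, Fin.val_succ, hH] at this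
  simpa [outputRel] using this

end Output

end TemporalSampling

end TemporalClustering

theorem mainTheorem1 :
    ∃ (p : Program) (c : ℕ), ∀ (X : Type*) [MetricSpace X] (t : ℕ) (P : TemporalSampling X t)
      (e : P.Enumeration),
      -- the program halts within `c n ^ 2` steps
      (∃ (s : State) (T : ℕ), Exec p (P.input e) s T ∧ T ≤ c * P.size ^ 2 ∧
        -- it returns a local clustering that is as good as any that exists
        (∀ χ δ : ℝ, P.Admits χ δ →
          P.IsLocalClustering χ δ (P.outputDist e s) (P.outputRel e s)) ∧
        -- each level is fitted with a nearest ultrametric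
        (∀ i, IsUltrametric (P.outputDist e s i) ∧
          ∀ ν : P.level i → P.level i → ℝ, IsPseudoUltrametric ν →
            LInf (P.ambient i) (P.outputDist e s i) ≤ LInf (P.ambient i) ν) ∧
        -- successive levels are linked by all pairs within the Hausdorff distance
        (∀ i : Fin t, P.outputRel e s i =
          {q | dist (q.1 : X) (q.2 : X) ≤ P.hausdorff i})) ∧
      -- the largest of these Hausdorff distances is the optimal locality
      IsLeast {δ : ℝ | ∃ χ : ℝ, P.Admits χ δ} (⨆ i : Fin t, P.hausdorff i) := by
  refine ⟨clusterProg, 400, fun X _ t P e => ⟨?_, P.isLeast_locality⟩⟩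
  obtain ⟨s, T, hexec, hT, B, v, u, E, H, h⟩ := P.clusterProg_terminates e
  refine ⟨s, T, hexec, hT, ?_, fun i => ⟨TemporalSampling.isUltrametric_outputDist h i,
    fun ν hν => TemporalSampling.LInf_outputDist_le h i hν⟩, TemporalSampling.outputRel_eq h⟩
  rintro χ δ ⟨μ, C, hμ⟩
  refine ⟨hμ.chi_nonneg, hμ.delta_nonneg,
    fun i => (TemporalSampling.isUltrametric_outputDist h i).toIsPseudoUltrametric,
    fun i => (TemporalSampling.LInf_outputDist_le h i (hμ.ultra i)).trans (hμ.fit i),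
    fun i => ?_, fun i q hq => ?_⟩
  · rw [TemporalSampling.outputRel_eq h]
    exact P.isCorrespondence_hausdorff i
  · rw [TemporalSampling.outputRel_eq h] at hq
    exact le_trans hq (hμ.hausdorff_le i)
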